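/- Let $A\subset\mathbb{R}^2$ be a finite point set with no three points collinear, and let $\omega:A\to\mathbb{R}$ be a height function such that no four of the lifted points $p'=(p,\omega(p))$, $p\in A$, lie in a common non-vertical plane. A triangulation of $A$ is a geometric simplicial complex with vertices in $A$ (not necessarily all of $A$) and underlying space $\mathrm{conv}(A)$. The regular (respectively farthest point regular) triangulation of $(A,\omega)$ is the projection to the plane of the lower (respectively upper) faces of $\mathrm{conv}\{p' : p\in A\}$. A flip with support $S\subseteq A$, $|S|=4$, replaces one of the two triangulations of $S$, contained in a triangulation of $A$ as a subcomplex, by the other one; it is a down-flip if it replaces the projected upper faces of the tetrahedron $\mathrm{conv}\{p':p\in S\}$ by the projected lower faces, and an up-flip in the opposite case. An edge $ab$ of a triangulation, shared by two triangles $abc$ and $abd$, is locally non-regular with respect to down-flips (up-flips) if $d'$ lies strictly below (above) the plane through $a',b',c'$; it is flippable if the triangulation contains a subcomplex triangulating $\{a,b,c,d\}$. Lawson's flip algorithm, with directed flips of a fixed direction (all down-flips or all up-flips), starts with a triangulation $T$ of $A$ and a stack containing all edges of $T$ in any order. While the stack is non-empty it pops an edge; if this edge belongs to the current triangulation, is locally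 non-regular with respect to that direction and is flippable, it performs the flip and pushes, in any order, the edges of the convex hull of the support of the flip; otherwise the edge is discarded. When the stack is empty and some point of $A$ that is not a vertex of the current triangulation can be inserted by a 1-3 flip of that direction, the algorithm performs one such flip, pushes the edges of the convex hull of its support and continues; if there is no such point, it stops. Then, for every initial triangulation of $A$: (1) If $\omega$ is convex (that is, it extends to a convex function on $\mathrm{conv}(A)$) and the directed flips are down-flips, then Lawson's flip algorithm terminates: every execution stops after finitely many steps, whatever choices are made, and the resulting triangulation is the regular triangulation of $(A,\omega)$. (2) If $\omega$ is concave (that is, it extends to a concave function on $\mathrm{conv}(A)$) and the directed flips are up-flips, then every execution of Lawson's flip algorithm stops after finitely many steps, and the resulting triangulation is the farthest point regular triangulation of $(A,\omega)$. In both cases the same holds for the version of the algorithm without a stack, which performs arbitrary flips of the given direction (down-flips in case (1), up-flips in case (2)), one after another, as long as one exists. -/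

import Mathlib

namespace LawsonFlip

/-- The Euclidean plane. -/
abbrev Plane : Type := EuclideanSpace ℝ (Fin 2)

/-- Planar simplicial complexes. Following Mathlib, the empty simplex is not listed as a face. -/
abbrev Complex : Type := Geometry.SimplicialComplex ℝ Plane

/-- A triangulation of the finite point set `A`: a geometric simplicial complex with vertices
in `A` (not necessarily all of them) whose underlying space is the convex hull of `A`. -/
def IsTriangulation (A : Finset Plane) (T : Complex) : Prop :=
  (∀ σ ∈ T.faces, σ ⊆ A) ∧ T.space = convexHull ℝ (A : Set Plane)

/-- No three points of `A` are collinear. -/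
def InGeneralPosition (A : Finset Plane) : Prop :=
  ∀ S ⊆ A, S.card = 3 → ¬ Collinear ℝ (S : Set Plane)

/-- No four lifted points `(p, ω p)`, `p ∈ A`, lie in a common non-vertical plane.
(Non-vertical planes in space are the graphs of affine functions on the plane.) -/
def IsGenericHeight (A : Finset Plane) (ω : Plane → ℝ) : Prop :=
  ∀ S ⊆ A, S.card = 4 → ¬ ∃ l : Plane →ᵃ[ℝ] ℝ, ∀ p ∈ S, l p = ω p

/-- The height function `ω` on `A` is convex: it extends to a convex function on `conv A`. -/
def IsConvexHeight (A : Finset Plane) (ω : Plane → ℝ) : Prop :=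
  ∃ g : Plane → ℝ, ConvexOn ℝ (convexHull ℝ (A : Set Plane)) g ∧ ∀ p ∈ A, g p = ω p

/-- The height function `ω` on `A` is concave: it extends to a concave function on `conv A`. -/
def IsConcaveHeight (A : Finset Plane) (ω : Plane → ℝ) : Prop :=
  ∃ g : Plane → ℝ, ConcaveOn ℝ (convexHull ℝ (A : Set Plane)) g ∧ ∀ p ∈ A, g p = ω p

/-- The projections to the plane (as vertex sets) of the non-empty lower faces, of all dimensions,
of the convex hull of the lifted points of `S`: the graph of `l` is a non-vertical supporting
plane, all lifted points lie on or above it, and those on it are the ones over `σ`. -/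
def lowerFaces (ω : Plane → ℝ) (S : Finset Plane) : Set (Finset Plane) :=
  {σ | σ.Nonempty ∧ σ ⊆ S ∧ ∃ l : Plane →ᵃ[ℝ] ℝ,
    ∀ p ∈ S, l p ≤ ω p ∧ (l p = ω p ↔ p ∈ σ)}

/-- The projections to the plane (as vertex sets) of the non-empty upper faces, of all dimensions,
of the convex hull of the lifted points of `S`. -/
def upperFaces (ω : Plane → ℝ) (S : Finset Plane) : Set (Finset Plane) :=
  {σ | σ.Nonempty ∧ σ ⊆ S ∧ ∃ l : Plane →ᵃ[ℝ] ℝ,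
    ∀ p ∈ S, ω p ≤ l p ∧ (l p = ω p ↔ p ∈ σ)}

/-- `T` is the (nearest point) regular triangulation of `(A, ω)`. -/
def IsRegularTriangulation (A : Finset Plane) (ω : Plane → ℝ) (T : Complex) : Prop :=
  IsTriangulation A T ∧ T.faces = lowerFaces ω A

/-- `T` is the farthest point regular triangulation of `(A, ω)`. -/
def IsFarthestRegularTriangulation (A : Finset Plane) (ω : Plane → ℝ) (T : Complex) : Prop :=
  IsTriangulation A T ∧ T.faces = upperFaces ω A

/-- The two directions of a flip. -/
inductive Direction
  | down
  | up

/-- The faces of the lifted tetrahedron over `S` that a directed flip removes. -/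
def sourceFaces : Direction → (Plane → ℝ) → Finset Plane → Set (Finset Plane)
  | .down => upperFaces
  | .up => lowerFaces

/-- The faces of the lifted tetrahedron over `S` that a directed flip inserts. -/
def targetFaces : Direction → (Plane → ℝ) → Finset Plane → Set (Finset Plane)
  | .down => lowerFaces
  | .up => upperFaces

/-- `T'` arises from `T` by a flip in direction `dir` supported on the four points `S`: one of the
two triangulations of `S` is a subcomplex of `T` and is replaced by the other one. For a down-flip
the upper faces of the lifted tetrahedron are replaced by its lower faces; for an up-flip
it is the other way around. This covers 2-2, 1-3 and 3-1 flips. -/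
def IsFlipOn (dir : Direction) (A : Finset Plane) (ω : Plane → ℝ) (S : Finset Plane)
    (T T' : Complex) : Prop :=
  IsTriangulation A T ∧ IsTriangulation A T' ∧ S ⊆ A ∧ S.card = 4 ∧
    sourceFaces dir ω S ⊆ T.faces ∧
    T'.faces = (T.faces \ sourceFaces dir ω S) ∪ targetFaces dir ω S

/-- `T'` arises from `T` by some flip in direction `dir`. -/
def IsDirectedFlip (dir : Direction) (A : Finset Plane) (ω : Plane → ℝ) (T T' : Complex) : Prop :=
  ∃ S : Finset Plane, IsFlipOn dir A ω S T T'

/-- Strict vertical comparison of heights: `z` is below `z'` (down) or above `z'` (up). -/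
def Beyond : Direction → ℝ → ℝ → Prop
  | .down => fun z z' => z < z'
  | .up => fun z z' => z' < z

/-- The edge `e` of `T` is locally non-regular with respect to flips in direction `dir`: it is
shared by two triangles `t₁` and `t₂` of `T`, and the lifted vertex of `t₂` opposite to `e` lies
strictly below (down), respectively above (up), the plane through the lifted vertices of `t₁`. -/
def IsLocallyNonRegular (dir : Direction) (ω : Plane → ℝ) (T : Complex)
    (e t₁ t₂ : Finset Plane) : Prop :=
  e.card = 2 ∧ t₁ ∈ T.faces ∧ t₁.card = 3 ∧ e ⊆ t₁ ∧ t₂ ∈ T.faces ∧ t₂.card = 3 ∧ e ⊆ t₂ ∧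
    t₁ ≠ t₂ ∧ ∃ l : Plane →ᵃ[ℝ] ℝ, (∀ p ∈ t₁, l p = ω p) ∧
      ∀ p ∈ t₂, p ∉ t₁ → Beyond dir (ω p) (l p)

/-- The edge `e` is locally non-regular in `T` and flippable, and flipping it yields `T'`. The
support `S` of the flip consists of the vertices of the two triangles sharing `e`. -/
def IsEdgeFlip (dir : Direction) (A : Finset Plane) (ω : Plane → ℝ) (e S : Finset Plane)
    (T T' : Complex) : Prop :=
  ∃ t₁ t₂ : Finset Plane, IsLocallyNonRegular dir ω T e t₁ t₂ ∧
    (S : Set Plane) = (t₁ : Set Plane) ∪ (t₂ : Set Plane) ∧ IsFlipOn dir A ω S T T'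

/-- The point `v ∈ A` is not a vertex of `T` and is inserted by a 1-3 flip in direction `dir`
with support `S`, which yields `T'`. -/
def IsVertexInsertion (dir : Direction) (A : Finset Plane) (ω : Plane → ℝ) (v : Plane)
    (S : Finset Plane) (T T' : Complex) : Prop :=
  v ∈ A ∧ {v} ∉ T.faces ∧ {v} ∈ T'.faces ∧ IsFlipOn dir A ω S T T'

/-- `e` is an edge of the convex hull of `S`. -/
def IsHullEdge (S e : Finset Plane) : Prop :=
  e ⊆ S ∧ e.card = 2 ∧ ∃ g : Plane →ᵃ[ℝ] ℝ, ∀ p ∈ S, 0 ≤ g p ∧ (g p = 0 ↔ p ∈ e)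

/-- `L` lists, in some order and without repetition, the edges of the convex hull of `S`. -/
def ListsHullEdges (S : Finset Plane) (L : List (Finset Plane)) : Prop :=
  L.Nodup ∧ ∀ e, e ∈ L ↔ IsHullEdge S e

/-- `L` lists, in some order and without repetition, the edges of `T`. -/
def ListsEdges (T : Complex) (L : List (Finset Plane)) : Prop :=
  L.Nodup ∧ ∀ e, e ∈ L ↔ e ∈ T.faces ∧ e.card = 2

/-- A state of Lawson's algorithm: the current triangulation and the stack of edges
(top of the stack first). -/
abbrev State : Type := Complex × List (Finset Plane)

/-- One step of Lawson's flip algorithm with flips in direction `dir`. -/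
inductive LawsonStep (dir : Direction) (A : Finset Plane) (ω : Plane → ℝ) : State → State → Prop
  /-- Pop an edge which is locally non-regular and flippable, flip it, and push the edges of the
  convex hull of the support of the flip. -/
  | flip (T T' : Complex) (e S : Finset Plane) (L N : List (Finset Plane)) :
      IsEdgeFlip dir A ω e S T T' → ListsHullEdges S N →
      LawsonStep dir A ω (T, e :: L) (T', N ++ L)
  /-- Pop any other edge; the triangulation does not change. -/
  | discard (T : Complex) (e : Finset Plane) (L : List (Finset Plane)) :
      (¬ ∃ (S : Finset Plane) (T' : Complex), IsEdgeFlip dir A ω e S T T') →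
      LawsonStep dir A ω (T, e :: L) (T, L)
  /-- When the stack is empty, insert a missing point of `A` by a 1-3 flip, and push the edges of
  the convex hull of the support of the flip. -/
  | insert (T T' : Complex) (v : Plane) (S : Finset Plane) (N : List (Finset Plane)) :
      IsVertexInsertion dir A ω v S T T' → ListsHullEdges S N →
      LawsonStep dir A ω (T, []) (T', N)

/-- Every execution of the (nondeterministic) procedure `step` started in `s₀` stops after finitely
many steps, and every state in which an execution stops satisfies `Q`. -/
def TerminatesIn {α : Type} (step : α → α → Prop) (s₀ : α) (Q : α → Prop) : Prop :=
  (¬ ∃ f : ℕ → α, f 0 = s₀ ∧ ∀ n, step (f n) (f (n + 1))) ∧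
    ∀ s, Relation.ReflTransGen step s₀ s → (∀ s', ¬ step s s') → Q s

end LawsonFlip

namespace LawsonFlip

/-! Four points of `A` carry, up to scaling, exactly one affine dependency `μ`, and no coefficient
of it vanishes; since heights are generic, its sign can be fixed by `0 < ∑ p ∈ S, μ p * ω p`. The
lower faces over `S` are then the nonempty subsets missing a point with `μ > 0`, and the upper faces
those missing a point with `μ < 0` (`IsCircuit.lowerFaces_eq`, `IsCircuit.upperFaces_eq`). Flips
thus become a matter of signs.

Termination: a down-flip never raises the lifted surface. Before a flip on `S` the surface contains
the upper faces over `S`; afterwards it runs strictly below them somewhere, and this persists. So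
each `S` supports at most one flip, which `flipRank` counts; for the stack version the stack length
accounts for discarded edges.

Correctness: convexity of `ω` excludes circuits whose positive part is a single point
(`IsConvexHeight.exists_pos_ne`). Hence every locally non-regular edge is flippable by a 2-2 flip,
and, if `A` has at least three points, every missing point can be inserted by a 1-3 down-flip. Where
no flip is left, all points are used and all edges are locally regular, which forces global
regularity (`IsTriangulation.isRegularTriangulation`). With a stack, the invariant is that every
locally non-regular edge is on it. The concave case follows by negating `ω`. -/

/-! ### Convex coordinates and affine independence. -/

/-- `w` is a system of convex coordinates of `x` with respect to the points of `s`. -/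
def IsWeight (s : Finset Plane) (w : Plane → ℝ) (x : Plane) : Prop :=
  (∀ p ∈ s, 0 ≤ w p) ∧ ∑ p ∈ s, w p = 1 ∧ ∑ p ∈ s, w p • p = x

theorem mem_convexHull_iff_exists_isWeight {s : Finset Plane} {x : Plane} :
    x ∈ convexHull ℝ (s : Set Plane) ↔ ∃ w, IsWeight s w x :=
  Finset.mem_convexHull'

theorem IsWeight.mem_convexHull {s : Finset Plane} {w : Plane → ℝ} {x : Plane}
    (h : IsWeight s w x) : x ∈ convexHull ℝ (s : Set Plane) :=
  mem_convexHull_iff_exists_isWeight.2 ⟨w, h⟩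

theorem IsWeight.restrict {s t : Finset Plane} {w : Plane → ℝ} {x : Plane}
    (h : IsWeight t w x) (hst : s ⊆ t) (h0 : ∀ p ∈ t, p ∉ s → w p = 0) : IsWeight s w x := by
  refine ⟨fun p hp => h.1 p (hst hp), ?_, ?_⟩
  · rw [Finset.sum_subset hst h0, h.2.1]
  · rw [Finset.sum_subset hst (fun p hp hps => by rw [h0 p hp hps, zero_smul]), h.2.2]

open Classical in
theorem IsWeight.extend {s t : Finset Plane} {w : Plane → ℝ} {x : Plane}
    (h : IsWeight s w x) (hst : s ⊆ t) : IsWeight t (fun p => if p ∈ s then w p else 0) x := by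
  refine ⟨fun p _ => ?_, ?_, ?_⟩
  · dsimp only
    split_ifs with hp
    exacts [h.1 p hp, le_rfl]
  · rw [← Finset.sum_subset hst (fun p _ hps => if_neg hps), ← h.2.1]
    exact Finset.sum_congr rfl fun p hp => if_pos hp
  · rw [← Finset.sum_subset hst (fun p _ hps => by simp [hps]), ← h.2.2]
    exact Finset.sum_congr rfl fun p hp => by simp [hp]

theorem sum_mul_affineMap (s : Finset Plane) (w : Plane → ℝ) (l : Plane →ᵃ[ℝ] ℝ) :
    ∑ p ∈ s, w p * l p = l.linear (∑ p ∈ s, w p • p) + (∑ p ∈ s, w p) * l 0 := by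
  rw [map_sum, Finset.sum_mul, ← Finset.sum_add_distrib]
  refine Finset.sum_congr rfl fun p _ => ?_
  have := congrFun l.decomp p
  simp only [Pi.add_apply] at this
  rw [this, map_smul, smul_eq_mul, mul_add]

theorem IsWeight.sum_mul_affineMap {s : Finset Plane} {w : Plane → ℝ} {x : Plane}
    (h : IsWeight s w x) (l : Plane →ᵃ[ℝ] ℝ) : ∑ p ∈ s, w p * l p = l x := by
  rw [LawsonFlip.sum_mul_affineMap, h.2.1, h.2.2, one_mul]
  exact (congrFun l.decomp x).symm

open Classical in
theorem affineIndependent_coe_iff (s : Finset Plane) :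
    AffineIndependent ℝ ((↑) : s → Plane) ↔ ∀ w : Plane → ℝ, ∑ p ∈ s, w p = 0 →
      ∑ p ∈ s, w p • p = 0 → ∀ p ∈ s, w p = 0 := by
  constructor
  · intro h w h0 h1 p hp
    refine affineIndependent_iff.1 h Finset.univ (fun q => w q) ?_ ?_ ⟨p, hp⟩ (Finset.mem_univ _)
    · rw [← h0]; exact Finset.sum_coe_sort s w
    · rw [← h1]; exact Finset.sum_coe_sort s (fun p => w p • p)
  · intro h
    rw [affineIndependent_iff]
    intro t w h0 h1 e he
    let w' : Plane → ℝ := fun p => if hp : p ∈ s then (if ⟨p, hp⟩ ∈ t then w ⟨p, hp⟩ else 0) else 0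
    have key : ∀ q : s, w' q = if q ∈ t then w q else 0 := fun q => by simp [w']
    have := h w' ?_ ?_ e e.2
    · simpa [key, he] using this
    · rw [← Finset.sum_coe_sort, ← h0]
      simp only [key]
      rw [Finset.sum_ite_mem, Finset.univ_inter]
    · rw [← Finset.sum_coe_sort s (fun p => w' p • p), ← h1]
      simp only [key, ite_smul, zero_smul]
      rw [Finset.sum_ite_mem, Finset.univ_inter]

theorem IsWeight.eq_of_affineIndependent {s : Finset Plane} {w w' : Plane → ℝ} {x : Plane}
    (hs : AffineIndependent ℝ ((↑) : s → Plane)) (h : IsWeight s w x) (h' : IsWeight s w' x) :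
    ∀ p ∈ s, w p = w' p := by
  intro p hp
  have := (affineIndependent_coe_iff s).1 hs (fun p => w p - w' p)
    (by rw [Finset.sum_sub_distrib, h.2.1, h'.2.1, sub_self])
    (by simp only [sub_smul]; rw [Finset.sum_sub_distrib, h.2.2, h'.2.2, sub_self]) p hp
  linarith

theorem exists_affineMap_eqOn {s : Finset Plane} (hs : AffineIndependent ℝ ((↑) : s → Plane))
    (c : Plane → ℝ) : ∃ l : Plane →ᵃ[ℝ] ℝ, ∀ p ∈ s, l p = c p := by
  classical
  obtain ⟨t, hst, ht, htop⟩ := exists_subset_affineIndependent_affineSpan_eq_top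
    (k := ℝ) (s := (s : Set Plane)) hs
  let b : AffineBasis t ℝ Plane := ⟨((↑) : t → Plane), ht, by simpa using htop⟩
  have : Finite t := b.finite
  have := Fintype.ofFinite t
  refine ⟨((Fintype.linearCombination ℝ (fun i : t => c i)).toAffineMap).comp b.coords, ?_⟩
  intro p hp
  have hb : p = b ⟨p, hst hp⟩ := rfl
  conv_lhs => rw [hb]
  simp [Fintype.linearCombination_apply, AffineBasis.coord_apply]

theorem exists_affine_coordinates {s : Finset Plane}
    (hs : AffineIndependent ℝ ((↑) : s → Plane)) (h3 : s.card = 3) (y : Plane) :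
    ∃ w : Plane → ℝ, ∑ p ∈ s, w p = 1 ∧ ∑ p ∈ s, w p • p = y := by
  classical
  have htop : affineSpan ℝ (Set.range ((↑) : s → Plane)) = ⊤ := by
    rw [hs.affineSpan_eq_top_iff_card_eq_finrank_add_one]
    simp [h3]
  let b : AffineBasis s ℝ Plane := ⟨((↑) : s → Plane), hs, htop⟩
  refine ⟨fun p => if hp : p ∈ s then b.coord ⟨p, hp⟩ y else 0, ?_, ?_⟩
  · rw [← Finset.sum_coe_sort, ← b.sum_coord_apply_eq_one y]
    exact Finset.sum_congr rfl fun i _ => by simp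
  · rw [← Finset.sum_coe_sort s (fun p => (if hp : p ∈ s then b.coord ⟨p, hp⟩ y else 0) • p)]
    conv_rhs => rw [← b.linear_combination_coord_eq_self y]
    exact Finset.sum_congr rfl fun i _ => by simp [b]; rfl

theorem InGeneralPosition.affineIndependent {A S : Finset Plane} (hA : InGeneralPosition A)
    (hS : S ⊆ A) (h3 : S.card ≤ 3) : AffineIndependent ℝ ((↑) : S → Plane) := by
  classical
  rw [affineIndependent_coe_iff]
  intro w h0 h1
  interval_cases h : S.card
  · simp_all
  · obtain ⟨a, rfl⟩ := Finset.card_eq_one.1 h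
    simpa using h0
  · obtain ⟨a, b, hab, rfl⟩ := Finset.card_eq_two.1 h
    rw [Finset.sum_pair hab] at h0 h1
    have hb : w b = - w a := by linarith
    have : w a • (a - b) = 0 := by rw [← h1, hb]; module
    have ha : w a = 0 := (smul_eq_zero.1 this).resolve_right (sub_ne_zero.2 hab)
    simp [ha, hb]
  · obtain ⟨a, b, c, hab, hac, hbc, rfl⟩ := Finset.card_eq_three.1 h
    have hc := hA _ hS h
    simp only [Finset.coe_insert, Finset.coe_singleton] at hc
    rw [← affineIndependent_iff_not_collinear_set, affineIndependent_iff] at hc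
    have := hc Finset.univ ![w a, w b, w c]
      (by simpa [Fin.sum_univ_three, hab, hac, hbc, add_assoc] using h0)
      (by simpa [Fin.sum_univ_three, hab, hac, hbc, add_assoc] using h1)
    have ha : w a = 0 := this 0 (Finset.mem_univ _)
    have hb : w b = 0 := this 1 (Finset.mem_univ _)
    have hc : w c = 0 := this 2 (Finset.mem_univ _)
    simp [ha, hb, hc]

theorem exists_small_perturbation (S : Finset Plane) (a b : Plane → ℝ) (h : ∀ p ∈ S, 0 < a p) :
    ∃ ε : ℝ, 0 < ε ∧ ε < 1 ∧ ∀ p ∈ S, 0 < a p + ε * b p := by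
  have h1 : ∀ᶠ ε in nhdsWithin (0 : ℝ) (Set.Ioi 0), ∀ p ∈ S, 0 < a p + ε * b p := by
    refine (Filter.eventually_all_finset S).2 fun p hp => nhdsWithin_le_nhds ?_
    have hc : Continuous fun ε : ℝ => a p + ε * b p := by fun_prop
    exact hc.continuousAt.eventually (lt_mem_nhds (by simpa using h p hp))
  have h2 : ∀ᶠ ε in nhdsWithin (0 : ℝ) (Set.Ioi 0), ε ∈ Set.Ioo (0 : ℝ) 1 :=
    Ioo_mem_nhdsGT one_pos
  obtain ⟨ε, h1, h2⟩ := (h1.and h2).exists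
  exact ⟨ε, h2.1, h2.2, h1⟩

/-! ### Circuits and their two triangulations. -/

/-- `μ` is, up to scaling, the only affine dependency of the points of `S`, and it involves all
of them. -/
structure IsCircuit (S : Finset Plane) (μ : Plane → ℝ) : Prop where
  nonempty : S.Nonempty
  ne_zero : ∀ p ∈ S, μ p ≠ 0
  sum_eq_zero : ∑ p ∈ S, μ p = 0
  sum_smul_eq_zero : ∑ p ∈ S, μ p • p = 0
  unique : ∀ ν : Plane → ℝ, ∑ p ∈ S, ν p = 0 → ∑ p ∈ S, ν p • p = 0 →
    ∃ t : ℝ, ∀ p ∈ S, ν p = t * μ p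

/-- The triangulation of a circuit `S` consisting of the sets of points that do not contain
the positive part of the dependency `μ`. -/
def halfFaces (S : Finset Plane) (μ : Plane → ℝ) : Set (Finset Plane) :=
  {σ | σ.Nonempty ∧ σ ⊆ S ∧ ∃ p ∈ S, 0 < μ p ∧ p ∉ σ}

theorem halfFaces_down_closed {S σ τ : Finset Plane} {μ : Plane → ℝ} (h : σ ∈ halfFaces S μ)
    (hτ : τ ⊆ σ) (hne : τ.Nonempty) : τ ∈ halfFaces S μ := by
  obtain ⟨-, hσ, p, hp, hμ, hpσ⟩ := h
  exact ⟨hne, hτ.trans hσ, p, hp, hμ, fun h => hpσ (hτ h)⟩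

namespace IsCircuit

variable {S : Finset Plane} {μ : Plane → ℝ}

protected theorem neg (C : IsCircuit S μ) : IsCircuit S (-μ) where
  nonempty := C.nonempty
  ne_zero p hp := by simpa using C.ne_zero p hp
  sum_eq_zero := by simp [C.sum_eq_zero]
  sum_smul_eq_zero := by simp [C.sum_smul_eq_zero]
  unique ν h0 h1 := by
    obtain ⟨t, ht⟩ := C.unique ν h0 h1
    exact ⟨-t, fun p hp => by simp [ht p hp]⟩

theorem exists_pos (C : IsCircuit S μ) : ∃ p ∈ S, 0 < μ p := by
  obtain ⟨p, hp⟩ := C.nonempty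
  exact Finset.exists_pos_of_sum_zero_of_exists_nonzero μ C.sum_eq_zero ⟨p, hp, C.ne_zero p hp⟩

theorem exists_neg (C : IsCircuit S μ) : ∃ p ∈ S, μ p < 0 := by
  simpa using C.neg.exists_pos

theorem sum_mul_affineMap (C : IsCircuit S μ) (l : Plane →ᵃ[ℝ] ℝ) : ∑ p ∈ S, μ p * l p = 0 := by
  rw [LawsonFlip.sum_mul_affineMap, C.sum_eq_zero, C.sum_smul_eq_zero]; simp

theorem isWeight_sub (C : IsCircuit S μ) {w : Plane → ℝ} {x : Plane} (h : IsWeight S w x) (t : ℝ)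
    (h0 : ∀ p ∈ S, 0 ≤ w p - t * μ p) : IsWeight S (fun p => w p - t * μ p) x := by
  refine ⟨h0, ?_, ?_⟩
  · rw [Finset.sum_sub_distrib, ← Finset.mul_sum, C.sum_eq_zero, h.2.1]; simp
  · simp only [sub_smul, mul_smul]
    rw [Finset.sum_sub_distrib, ← Finset.smul_sum, C.sum_smul_eq_zero, h.2.2]; simp

/-- Subtracting multiples of `μ` does not move the point, so one slides until the first coordinate
on the positive part vanishes. The amount `t` is kept because `t * ∑ p ∈ S, μ p * ω p` is the
resulting change of height. -/
theorem exists_isWeight_halfFaces (C : IsCircuit S μ) {w : Plane → ℝ} {x : Plane}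
    (h : IsWeight S w x) : ∃ t : ℝ, 0 ≤ t ∧ ∃ σ ∈ halfFaces S μ,
      IsWeight σ (fun p => w p - t * μ p) x ∧ ∀ p ∈ S, p ∉ σ → w p - t * μ p = 0 := by
  classical
  obtain ⟨p₀, hp₀, hμ₀⟩ := C.exists_pos
  obtain ⟨q, hq, hmin⟩ := Finset.exists_min_image (S.filter (0 < μ ·)) (fun p => w p / μ p)
    ⟨p₀, by simp [hp₀, hμ₀]⟩
  simp only [Finset.mem_filter] at hq hmin
  have ht : 0 ≤ w q / μ q := div_nonneg (h.1 q hq.1) hq.2.le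
  have h0 : ∀ p ∈ S, 0 ≤ w p - w q / μ q * μ p := by
    intro p hp
    rcases lt_or_ge 0 (μ p) with hμ | hμ
    · have := (le_div_iff₀ hμ).1 (hmin p ⟨hp, hμ⟩)
      linarith
    · have := mul_nonpos_of_nonneg_of_nonpos ht hμ
      have := h.1 p hp
      linarith
  have hz : ∀ p ∈ S, p ∉ S.erase q → w p - w q / μ q * μ p = 0 := by
    intro p hp hpq
    have : p = q := by
      by_contra hne
      exact hpq (Finset.mem_erase.2 ⟨hne, hp⟩)
    subst this
    rw [div_mul_cancel₀ _ hq.2.ne', sub_self]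
  refine ⟨w q / μ q, ht, S.erase q, ⟨?_, Finset.erase_subset _ _, q, hq.1, hq.2,
    Finset.notMem_erase _ _⟩, (C.isWeight_sub h _ h0).restrict (Finset.erase_subset _ _) hz, hz⟩
  obtain ⟨r, hr, hμr⟩ := C.exists_neg
  exact ⟨r, Finset.mem_erase.2 ⟨fun e => by rw [e] at hμr; linarith [hq.2], hr⟩⟩

theorem exists_mem_halfFaces (C : IsCircuit S μ) {x : Plane}
    (h : x ∈ convexHull ℝ (S : Set Plane)) :
    ∃ σ ∈ halfFaces S μ, x ∈ convexHull ℝ (σ : Set Plane) := by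
  obtain ⟨w, hw⟩ := mem_convexHull_iff_exists_isWeight.1 h
  obtain ⟨t, -, σ, hσ, hw', -⟩ := C.exists_isWeight_halfFaces hw
  exact ⟨σ, hσ, hw'.mem_convexHull⟩

/-- Two coordinate systems of a common point differ by `t * μ`. At a positive point missing from `σ`
this gives `t ≤ 0`, and symmetrically `0 ≤ t`; so they agree and are supported on `σ ∩ τ`. -/
theorem halfFaces_inter (C : IsCircuit S μ) {σ τ : Finset Plane} (hσ : σ ∈ halfFaces S μ)
    (hτ : τ ∈ halfFaces S μ) : convexHull ℝ (σ : Set Plane) ∩ convexHull ℝ (τ : Set Plane) ⊆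
      convexHull ℝ ((σ : Set Plane) ∩ (τ : Set Plane)) := by
  classical
  have main : ∀ {σ τ : Finset Plane} {w w' : Plane → ℝ} {x : Plane} {t : ℝ}, σ ∈ halfFaces S μ →
      τ ∈ halfFaces S μ → IsWeight σ w x → IsWeight τ w' x → 0 ≤ t →
      (∀ p ∈ S, (if p ∈ σ then w p else 0) - (if p ∈ τ then w' p else 0) = t * μ p) → t = 0 := by
    intro σ τ w w' x t hσ hτ hw hw' ht h
    obtain ⟨-, -, p, hp, hμ, hpσ⟩ := hσ
    have := h p hp
    rw [if_neg hpσ] at this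
    have h2 := (hw'.extend hτ.2.1).1 p hp
    dsimp only at h2
    have : t * μ p ≤ 0 := by linarith
    by_contra hne
    exact absurd (mul_pos (lt_of_le_of_ne ht (Ne.symm hne)) hμ) (by linarith)
  rintro x ⟨hxσ, hxτ⟩
  obtain ⟨w, hw⟩ := mem_convexHull_iff_exists_isWeight.1 hxσ
  obtain ⟨w', hw'⟩ := mem_convexHull_iff_exists_isWeight.1 hxτ
  have e := hw.extend hσ.2.1
  have e' := hw'.extend hτ.2.1
  obtain ⟨t, ht⟩ := C.unique
    (fun p => (if p ∈ σ then w p else 0) - (if p ∈ τ then w' p else 0))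
    (by rw [Finset.sum_sub_distrib, e.2.1, e'.2.1, sub_self])
    (by simp only [sub_smul]; rw [Finset.sum_sub_distrib]; exact sub_eq_zero.2 (e.2.2.trans e'.2.2.symm))
  have ht0 : t = 0 := by
    rcases le_total 0 t with h | h
    · exact main hσ hτ hw hw' h ht
    · have := main hτ hσ hw' hw (neg_nonneg.2 h) (fun p hp => by rw [neg_mul, ← ht p hp]; ring)
      linarith
  subst ht0
  have : IsWeight (σ ∩ τ) w x := by
    refine hw.restrict Finset.inter_subset_left fun p hp hpn => ?_
    have hpτ : p ∉ τ := fun h => hpn (Finset.mem_inter.2 ⟨hp, h⟩)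
    simpa [hp, hpτ] using ht p (hσ.2.1 hp)
  simpa using this.mem_convexHull

/-- Such a `ρ` is interior to `conv S`: subtracting a small multiple of `μ` makes all coordinates of
`x` positive, which leaves room to move towards any `y`. -/
theorem exists_lineMap_mem_convexHull (C : IsCircuit S μ) {ρ : Finset Plane} (hρS : ρ ⊆ S)
    (hρ : ∀ p ∈ S, 0 < μ p → p ∈ ρ) {w : Plane → ℝ} {x : Plane} (hw : IsWeight ρ w x)
    (hpos : ∀ p ∈ ρ, 0 < w p) {ν : Plane → ℝ} {y : Plane} (hν : ∑ p ∈ S, ν p = 1)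
    (hνy : ∑ p ∈ S, ν p • p = y) :
    ∃ ε : ℝ, 0 < ε ∧ ε < 1 ∧ (1 - ε) • x + ε • y ∈ convexHull ℝ (S : Set Plane) := by
  classical
  obtain ⟨t, ht0, -, ht⟩ := exists_small_perturbation ρ w (-μ) hpos
  have hu : ∀ p ∈ S, 0 < (if p ∈ ρ then w p else 0) - t * μ p := by
    intro p hp
    split_ifs with h
    · have := ht p h
      simp only [Pi.neg_apply] at this
      linarith
    · have h1 : μ p < 0 := lt_of_le_of_ne (not_lt.1 fun h2 => h (hρ p hp h2)) (C.ne_zero p hp)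
      nlinarith [mul_pos ht0 (neg_pos.2 h1)]
  have hU := C.isWeight_sub (hw.extend hρS) t fun p hp => (hu p hp).le
  generalize hue : (fun p => (if p ∈ ρ then w p else 0) - t * μ p) = u at hU
  have hu' : ∀ p ∈ S, 0 < u p := fun p hp => by rw [← hue]; exact hu p hp
  obtain ⟨ε, h0, h1, hε⟩ := exists_small_perturbation S u (fun p => ν p - u p) hu'
  refine ⟨ε, h0, h1, (?_ : IsWeight S (fun p => (1 - ε) * u p + ε * ν p) _).mem_convexHull⟩
  refine ⟨fun p hp => ?_, ?_, ?_⟩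
  · have := hε p hp
    dsimp only
    linarith
  · rw [Finset.sum_add_distrib, ← Finset.mul_sum, ← Finset.mul_sum, hU.2.1, hν]; ring
  · simp only [add_smul, mul_smul]
    rw [Finset.sum_add_distrib, ← Finset.smul_sum, ← Finset.smul_sum, hU.2.2, hνy]

/-- For every affine `l`, the sum of `μ p * (l p - ω p)` is negative, so an upper supporting plane
cannot touch all negative points. Conversely, if `q` is a negative point outside `σ`, the plane is
prescribed on the other three points, and the dependency puts it above `q`. -/
theorem upperFaces_eq (C : IsCircuit S μ) {ω : Plane → ℝ} (hD : 0 < ∑ p ∈ S, μ p * ω p)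
    (hind : ∀ q ∈ S, AffineIndependent ℝ ((↑) : S.erase q → Plane)) :
    upperFaces ω S = halfFaces S (-μ) := by
  ext σ
  have key : ∀ l : Plane →ᵃ[ℝ] ℝ, ∑ p ∈ S, μ p * (l p - ω p) < 0 := by
    intro l
    simp only [mul_sub]
    rw [Finset.sum_sub_distrib, C.sum_mul_affineMap]
    linarith
  constructor
  · rintro ⟨hne, hσ, l, hl⟩
    refine ⟨hne, hσ, ?_⟩
    by_contra! hcon
    refine absurd (Finset.sum_nonneg fun p hp => ?_) (not_le.2 (key l))
    rcases lt_or_ge (μ p) 0 with h | h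
    · rw [((hl p hp).2).2 (hcon p hp (by simpa using h)), sub_self, mul_zero]
    · exact mul_nonneg h (sub_nonneg.2 (hl p hp).1)
  · rintro ⟨hne, hσ, q, hq, hμq, hqσ⟩
    simp only [Pi.neg_apply, Left.neg_pos_iff] at hμq
    refine ⟨hne, hσ, ?_⟩
    classical
    -- Both functions are constant in the point, so this only chooses `ε` in one scalar inequality.
    -- Lifting the plane by `ε` off `σ` makes it touch nothing else, and `ε` is small enough not to
    -- spoil the sign at `q`.
    obtain ⟨ε, hε0, -, hε⟩ := exists_small_perturbation S
      (fun _ => ∑ p ∈ S, μ p * ω p) (fun _ => ∑ p ∈ S.erase q, μ p * (if p ∈ σ then 0 else 1))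
      (fun _ _ => hD)
    have hε := hε q hq
    obtain ⟨l, hl⟩ := exists_affineMap_eqOn (hind q hq)
      (fun p => ω p + ε * (if p ∈ σ then 0 else 1))
    have hlq : ω q < l q := by
      have h1 := C.sum_mul_affineMap l
      rw [← Finset.add_sum_erase S _ hq] at h1 hε
      have h2 : ∑ p ∈ S.erase q, μ p * l p = ∑ p ∈ S.erase q, μ p * ω p +
          ε * ∑ p ∈ S.erase q, μ p * (if p ∈ σ then 0 else 1) := by
        rw [Finset.mul_sum, ← Finset.sum_add_distrib]
        refine Finset.sum_congr rfl fun p hp => ?_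
        rw [hl p hp]; ring
      rw [h2] at h1
      by_contra hcon
      have := mul_le_mul_of_nonpos_left (not_lt.1 hcon) hμq.le
      linarith
    refine ⟨l, fun p hp => ?_⟩
    by_cases hpq : p = q
    · subst hpq
      exact ⟨hlq.le, fun h => absurd h hlq.ne', fun h => absurd h hqσ⟩
    · rw [hl p (Finset.mem_erase.2 ⟨hpq, hp⟩)]
      by_cases hpσ : p ∈ σ
      · simp [hpσ]
      · simp [hpσ, hε0.le, hε0.ne']

end IsCircuit

theorem lowerFaces_eq_upperFaces_neg (ω : Plane → ℝ) (S : Finset Plane) :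
    lowerFaces ω S = upperFaces (-ω) S := by
  ext σ
  refine and_congr_right fun _ => and_congr_right fun _ => ⟨?_, ?_⟩ <;> rintro ⟨l, hl⟩ <;>
    refine ⟨-l, fun p hp => ?_⟩ <;> have := hl p hp <;> constructor
  · simpa using this.1
  · simpa using this.2
  · simpa using neg_le_neg this.1
  · rw [← this.2]
    simp [neg_eq_iff_eq_neg]

theorem upperFaces_eq_lowerFaces_neg (ω : Plane → ℝ) (S : Finset Plane) :
    upperFaces ω S = lowerFaces (-ω) S := by
  rw [lowerFaces_eq_upperFaces_neg, neg_neg]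

theorem IsCircuit.lowerFaces_eq {S : Finset Plane} {μ : Plane → ℝ} (C : IsCircuit S μ)
    {ω : Plane → ℝ} (hD : 0 < ∑ p ∈ S, μ p * ω p)
    (hind : ∀ q ∈ S, AffineIndependent ℝ ((↑) : S.erase q → Plane)) :
    lowerFaces ω S = halfFaces S μ := by
  rw [lowerFaces_eq_upperFaces_neg, C.neg.upperFaces_eq (by simpa using hD) hind, neg_neg]

theorem InGeneralPosition.affineIndependent_erase {A S : Finset Plane}
    (hA : InGeneralPosition A) (hS : S ⊆ A) (h4 : S.card = 4) {q : Plane} (hq : q ∈ S) :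
    AffineIndependent ℝ ((↑) : S.erase q → Plane) := by
  refine hA.affineIndependent ((Finset.erase_subset _ _).trans hS) ?_
  rw [Finset.card_erase_of_mem hq, h4]

/-- Four points of the plane are affinely dependent. A dependency vanishing at one of them lives on
three affinely independent points, hence is zero; this gives nonvanishing and uniqueness. If the
height sum were zero, the plane through three lifted points would contain the fourth. -/
theorem InGeneralPosition.exists_isCircuit {A S : Finset Plane} {ω : Plane → ℝ}
    (hA : InGeneralPosition A) (hω : IsGenericHeight A ω) (hS : S ⊆ A) (h4 : S.card = 4) :
    ∃ μ, IsCircuit S μ ∧ 0 < ∑ p ∈ S, μ p * ω p := by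
  obtain ⟨μ, h1, h0, x, hx, hμx⟩ :=
    Module.exists_nontrivial_relation_sum_zero_of_finrank_succ_lt_card (R := ℝ) (t := S)
      (by simp [h4])
  have hvan : ∀ ν : Plane → ℝ, ∑ p ∈ S, ν p = 0 → ∑ p ∈ S, ν p • p = 0 → ∀ q ∈ S, ν q = 0 →
      ∀ p ∈ S, ν p = 0 := by
    intro ν h0 h1 q hq hν p hp
    by_cases hpq : p = q
    · rw [hpq, hν]
    · rw [← Finset.add_sum_erase S _ hq, hν] at h0 h1
      exact (affineIndependent_coe_iff _).1 (hA.affineIndependent_erase hS h4 hq) ν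
        (by simpa using h0) (by simpa using h1) p (Finset.mem_erase.2 ⟨hpq, hp⟩)
  have C : IsCircuit S μ := by
    refine ⟨⟨x, hx⟩, fun p hp h => hμx (hvan μ h0 h1 p hp h x hx), h0, h1, fun ν g0 g1 => ?_⟩
    refine ⟨ν x / μ x, fun p hp => ?_⟩
    have := hvan (fun p => ν p - ν x / μ x * μ p)
      (by rw [Finset.sum_sub_distrib, ← Finset.mul_sum, g0, h0]; simp)
      (by
        simp only [sub_smul, mul_smul]
        rw [Finset.sum_sub_distrib, ← Finset.smul_sum, g1, h1]; simp)
      x hx (by rw [div_mul_cancel₀ _ hμx, sub_self]) p hp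
    linarith
  have hD : ∑ p ∈ S, μ p * ω p ≠ 0 := by
    intro hD
    obtain ⟨l, hl⟩ := exists_affineMap_eqOn (hA.affineIndependent_erase hS h4 hx) ω
    have h2 := C.sum_mul_affineMap l
    rw [← Finset.add_sum_erase S _ hx] at h2 hD
    rw [Finset.sum_congr rfl fun p hp => by rw [hl p hp]] at h2
    have hlx : l x = ω x := mul_left_cancel₀ hμx (by linarith)
    refine hω S hS h4 ⟨l, fun p hp => ?_⟩
    by_cases hpx : p = x
    · rw [hpx, hlx]
    · exact hl p (Finset.mem_erase.2 ⟨hpx, hp⟩)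
  rcases hD.lt_or_gt with h | h
  · exact ⟨-μ, C.neg, by simpa using h⟩
  · exact ⟨μ, C, h⟩

/-! ### Local structure of a triangulation. -/

theorem exists_isWeight_pos {σ : Finset Plane} (h : σ.Nonempty) :
    ∃ w x, IsWeight σ w x ∧ ∀ p ∈ σ, 0 < w p := by
  have hc : (0 : ℝ) < σ.card := by exact_mod_cast h.card_pos
  refine ⟨fun _ => (σ.card : ℝ)⁻¹, _, ⟨fun _ _ => by positivity, ?_, rfl⟩, fun _ _ => by positivity⟩
  rw [Finset.sum_const, nsmul_eq_mul, mul_inv_cancel₀ hc.ne']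

theorem IsWeight.lineMap {s : Finset Plane} {w w' : Plane → ℝ} {x y : Plane}
    (h : IsWeight s w x) (h' : IsWeight s w' y) {ε : ℝ} (h0 : 0 ≤ ε) (h1 : ε ≤ 1) :
    IsWeight s (fun p => (1 - ε) * w p + ε * w' p) ((1 - ε) • x + ε • y) := by
  refine ⟨fun p hp => ?_, ?_, ?_⟩
  · exact add_nonneg (mul_nonneg (by linarith) (h.1 p hp)) (mul_nonneg h0 (h'.1 p hp))
  · rw [Finset.sum_add_distrib, ← Finset.mul_sum, ← Finset.mul_sum, h.2.1, h'.2.1]; ring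
  · simp only [add_smul, mul_smul]
    rw [Finset.sum_add_distrib, ← Finset.smul_sum, ← Finset.smul_sum, h.2.2, h'.2.2]

/-- A point in the relative interior of `σ` that lies in `τ` lies in `conv (σ ∩ τ)`; uniqueness of
coordinates then puts all of `σ` in `τ`. -/
theorem subset_of_isWeight_pos {T : Complex} {σ τ : Finset Plane} (hσ : σ ∈ T.faces)
    (hτ : τ ∈ T.faces) {w : Plane → ℝ} {x : Plane} (hw : IsWeight σ w x)
    (hpos : ∀ p ∈ σ, 0 < w p) (hx : x ∈ convexHull ℝ (τ : Set Plane)) : σ ⊆ τ := by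
  classical
  have h := T.inter_subset_convexHull hσ hτ ⟨hw.mem_convexHull, hx⟩
  rw [← Finset.coe_inter] at h
  obtain ⟨w', hw'⟩ := mem_convexHull_iff_exists_isWeight.1 h
  intro p hp
  have h1 := hw.eq_of_affineIndependent (T.indep hσ)
    (hw'.extend Finset.inter_subset_left) p hp
  have h2 := hpos p hp
  rw [h1] at h2
  by_contra hpτ
  simp [hpτ] at h2

namespace IsTriangulation

variable {A : Finset Plane} {T : Complex}

theorem finite_faces (hT : IsTriangulation A T) : T.faces.Finite :=
  A.powerset.finite_toSet.subset fun σ hσ => by simpa using hT.1 σ hσ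

/-- The faces are finitely many closed sets, so points close enough to `x` lie only in faces through
`x`, and these contain `σ`. -/
theorem exists_face_lineMap (hT : IsTriangulation A T) {σ : Finset Plane} (hσ : σ ∈ T.faces)
    {w : Plane → ℝ} {x y : Plane} (hw : IsWeight σ w x) (hpos : ∀ p ∈ σ, 0 < w p)
    (hy : y ∈ convexHull ℝ (A : Set Plane)) : ∃ τ ∈ T.faces, σ ⊆ τ ∧ ∃ ε : ℝ, 0 < ε ∧ ε < 1 ∧
      (1 - ε) • x + ε • y ∈ convexHull ℝ (τ : Set Plane) := by
  have h1 : ∀ᶠ ε in nhdsWithin (0 : ℝ) (Set.Ioi 0), ∀ τ ∈ T.faces,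
      x ∉ convexHull ℝ (τ : Set Plane) →
        (1 - ε) • x + ε • y ∉ convexHull ℝ (τ : Set Plane) := by
    refine (Filter.eventually_all_finite hT.finite_faces).2 fun τ _ => nhdsWithin_le_nhds ?_
    by_cases hxτ : x ∈ convexHull ℝ (τ : Set Plane)
    · exact Filter.Eventually.of_forall fun _ h => absurd hxτ h
    · have hc : Continuous fun ε : ℝ => (1 - ε) • x + ε • y := by fun_prop
      have ho : IsOpen (convexHull ℝ (τ : Set Plane))ᶜ :=
        (τ.finite_toSet.isClosed_convexHull ℝ).isOpen_compl
      filter_upwards [hc.continuousAt.eventually_mem (ho.mem_nhds (x := (1 - (0 : ℝ)) • x + (0 : ℝ) • y)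
        (by simpa using hxτ))] with ε hε _ using hε
  have h2 : ∀ᶠ ε in nhdsWithin (0 : ℝ) (Set.Ioi 0), ε ∈ Set.Ioo (0 : ℝ) 1 :=
    Ioo_mem_nhdsGT one_pos
  obtain ⟨ε, h1, h2⟩ := (h1.and h2).exists
  have hx : x ∈ convexHull ℝ (A : Set Plane) :=
    convexHull_mono (by exact_mod_cast hT.1 σ hσ) hw.mem_convexHull
  have hz : (1 - ε) • x + ε • y ∈ T.space := by
    rw [hT.2]
    exact convex_convexHull ℝ _ hx hy (by linarith [h2.2]) h2.1.le (by ring)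
  obtain ⟨τ, hτ, hzτ⟩ := T.mem_space_iff.1 hz
  have hxτ : x ∈ convexHull ℝ (τ : Set Plane) := by
    by_contra h
    exact h1 τ hτ h hzτ
  exact ⟨τ, hτ, subset_of_isWeight_pos hσ hτ hw hpos hxτ, ε, h2.1, h2.2, hzτ⟩

theorem exists_ssubset (hT : IsTriangulation A T) (hA : InGeneralPosition A) {σ : Finset Plane}
    (hσ : σ ∈ T.faces) (h2 : σ.card < 3) (h3 : 3 ≤ A.card) : ∃ τ ∈ T.faces, σ ⊂ τ := by
  classical
  obtain ⟨p, hpA, hpσ⟩ := Finset.exists_mem_notMem_of_card_lt_card (h2.trans_le h3)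
  obtain ⟨w, x, hw, hpos⟩ := exists_isWeight_pos (T.nonempty_of_mem_faces hσ)
  obtain ⟨τ, hτ, hστ, ε, h0, h1, hz⟩ := hT.exists_face_lineMap hσ hw hpos
    (subset_convexHull ℝ _ (Finset.mem_coe.2 hpA))
  refine ⟨τ, hτ, hστ.ssubset_of_ne ?_⟩
  rintro rfl
  obtain ⟨w', hw'⟩ := mem_convexHull_iff_exists_isWeight.1 hz
  have hind := hA.affineIndependent (S := insert p σ) (Finset.insert_subset hpA (hT.1 σ hσ))
    ((Finset.card_insert_le _ _).trans h2)
  have hp : IsWeight {p} (fun _ => 1) p := ⟨by simp, by simp, by simp⟩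
  have e := ((hw.extend (Finset.subset_insert p σ)).lineMap
    (hp.extend (t := insert p σ) (by simp)) h0.le h1.le).eq_of_affineIndependent hind
    (hw'.extend (Finset.subset_insert p σ)) p (Finset.mem_insert_self _ _)
  simp [hpσ] at e
  exact h0.ne' e

theorem exists_triangle (hT : IsTriangulation A T) (hA : InGeneralPosition A) {σ : Finset Plane}
    (hσ : σ ∈ T.faces) (h3 : 3 ≤ A.card) : ∃ t ∈ T.faces, σ ⊆ t ∧ t.card = 3 := by
  classical
  obtain ⟨t, ⟨ht, hσt⟩, hmax⟩ := Set.exists_max_image {τ | τ ∈ T.faces ∧ σ ⊆ τ} Finset.card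
    (hT.finite_faces.subset fun _ h => h.1) ⟨σ, hσ, Finset.Subset.refl _⟩
  have hge : 3 ≤ t.card := by
    by_contra h
    obtain ⟨τ, hτ, hlt⟩ := hT.exists_ssubset hA ht (not_le.1 h) h3
    exact absurd (Finset.card_lt_card hlt) (not_lt.2 (hmax τ ⟨hτ, hσt.trans hlt.1⟩))
  have hle := (T.indep ht).card_le_finrank_succ
  have hfr := Submodule.finrank_le (vectorSpan ℝ (Set.range ((↑) : t → Plane)))
  simp only [finrank_euclideanSpace, Fintype.card_fin, Fintype.card_coe] at hle hfr
  exact ⟨t, ht, hσt, by omega⟩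

open Classical in
theorem exists_neighbor (hT : IsTriangulation A T) {e : Finset Plane} (he : e ∈ T.faces)
    {g : Plane →ᵃ[ℝ] ℝ} (hg : ∀ q ∈ e, g q = 0) {p : Plane} (hp : p ∈ A) (hgp : g p < 0) :
    ∃ d, g d < 0 ∧ insert d e ∈ T.faces := by
  obtain ⟨w, x, hw, hpos⟩ := exists_isWeight_pos (T.nonempty_of_mem_faces he)
  obtain ⟨τ, hτ, heτ, ε, h0, h1, hz⟩ := hT.exists_face_lineMap he hw hpos
    (subset_convexHull ℝ _ (Finset.mem_coe.2 hp))
  have hgx : g x = 0 := by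
    rw [← hw.sum_mul_affineMap g]
    exact Finset.sum_eq_zero fun q hq => by rw [hg q hq, mul_zero]
  have hgz : g ((1 - ε) • x + ε • p) < 0 := by
    have := Convex.combo_affine_apply (f := g) (x := x) (y := p) (a := 1 - ε) (b := ε) (by ring)
    rw [this, hgx]
    simpa using mul_neg_of_pos_of_neg h0 hgp
  obtain ⟨w', hw'⟩ := mem_convexHull_iff_exists_isWeight.1 hz
  have : ∃ d ∈ τ, g d < 0 := by
    by_contra! hcon
    rw [← hw'.sum_mul_affineMap g] at hgz
    exact absurd (Finset.sum_nonneg fun d hd => mul_nonneg (hw'.1 d hd) (hcon d hd))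
      (not_le.2 hgz)
  obtain ⟨d, hd, hgd⟩ := this
  exact ⟨d, hgd, T.down_closed hτ (Finset.insert_subset hd heτ) (Finset.insert_nonempty _ _)⟩

/-! ### Exchanging the two triangulations of a circuit. -/

variable {S : Finset Plane} {μ : Plane → ℝ}

theorem mem_halfFaces_of_subset (C : IsCircuit S μ) (hsrc : halfFaces S μ ⊆ T.faces)
    {σ : Finset Plane} (hσ : σ ∈ T.faces) (hσS : σ ⊆ S) : σ ∈ halfFaces S μ := by
  have hne := T.nonempty_of_mem_faces hσ
  obtain ⟨w, x, hw, hpos⟩ := exists_isWeight_pos hne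
  obtain ⟨κ, hκ, hx⟩ := C.exists_mem_halfFaces (x := x)
    (convexHull_mono (by exact_mod_cast hσS) hw.mem_convexHull)
  exact halfFaces_down_closed hκ (subset_of_isWeight_pos hσ (hsrc hκ) hw hpos hx) hne

/-- Here `ρ` contains all negative points of `μ`, so it is interior to `conv S`. A short step from
its relative interior into that of `σ` stays in `conv S`, hence in an old face `κ`, and this forces
`σ ⊆ κ`. -/
theorem mem_halfFaces_of_star (hA : InGeneralPosition A) (hS : S ⊆ A) (h4 : S.card = 4)
    (C : IsCircuit S μ) (hsrc : halfFaces S μ ⊆ T.faces) {ρ σ : Finset Plane}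
    (hρ : ρ ∈ halfFaces S μ) (hρ' : ρ ∉ halfFaces S (-μ)) (hσ : σ ∈ T.faces) (hρσ : ρ ⊆ σ) :
    σ ∈ halfFaces S μ := by
  classical
  have hρ'' : ∀ p ∈ S, 0 < (-μ) p → p ∈ ρ := by
    intro p hp h
    by_contra hpρ
    exact hρ' ⟨hρ.1, hρ.2.1, p, hp, h, hpρ⟩
  obtain ⟨w, x, hw, hpos⟩ := exists_isWeight_pos hρ.1
  obtain ⟨w', y, hw', hpos'⟩ := exists_isWeight_pos (T.nonempty_of_mem_faces hσ)
  obtain ⟨q, hq⟩ := C.nonempty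
  obtain ⟨ν, hν, hνy⟩ := exists_affine_coordinates (hA.affineIndependent_erase hS h4 hq)
    (by rw [Finset.card_erase_of_mem hq, h4]) y
  obtain ⟨ε, h0, h1, hz⟩ := C.neg.exists_lineMap_mem_convexHull hρ.2.1 hρ'' hw hpos
    (ν := fun p => if p = q then 0 else ν p) (y := y)
    (by
      rw [← Finset.add_sum_erase S _ hq, if_pos rfl, zero_add, ← hν]
      exact Finset.sum_congr rfl fun p hp => if_neg (Finset.ne_of_mem_erase hp))
    (by
      rw [← Finset.add_sum_erase S _ hq, if_pos rfl, zero_smul, zero_add, ← hνy]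
      exact Finset.sum_congr rfl fun p hp => by rw [if_neg (Finset.ne_of_mem_erase hp)])
  obtain ⟨κ, hκ, hzκ⟩ := C.exists_mem_halfFaces hz
  have hW := (hw.extend hρσ).lineMap hw' h0.le h1.le
  refine halfFaces_down_closed hκ (subset_of_isWeight_pos hσ (hsrc hκ) hW (fun p hp => ?_) hzκ)
    (T.nonempty_of_mem_faces hσ)
  exact add_pos_of_nonneg_of_pos (mul_nonneg (by linarith) ((hw.extend hρσ).1 p hp))
    (mul_pos h0 (hpos' p hp))

/-- Surviving faces meet `conv S` only in faces common to both triangulations of `S`, because by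
`mem_halfFaces_of_star` everything around an interior face is removed. So the new half fits wherever
the old one did. -/
theorem exists_exchange (hT : IsTriangulation A T) (hA : InGeneralPosition A) (hS : S ⊆ A)
    (h4 : S.card = 4) (C : IsCircuit S μ) (hsrc : halfFaces S μ ⊆ T.faces) :
    ∃ T', IsTriangulation A T' ∧ T'.faces = (T.faces \ halfFaces S μ) ∪ halfFaces S (-μ) := by
  classical
  have hmix : ∀ {σ τ}, σ ∈ T.faces \ halfFaces S μ → τ ∈ halfFaces S (-μ) →
      convexHull ℝ (σ : Set Plane) ∩ convexHull ℝ (τ : Set Plane) ⊆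
        convexHull ℝ ((σ : Set Plane) ∩ (τ : Set Plane)) := by
    rintro σ τ hσ hτ x ⟨hxσ, hxτ⟩
    obtain ⟨κ, hκ, hxκ⟩ := C.exists_mem_halfFaces (x := x)
      (convexHull_mono (by exact_mod_cast hτ.2.1) hxτ)
    have hx := T.inter_subset_convexHull (hsrc hκ) hσ.1 ⟨hxκ, hxσ⟩
    rw [← Finset.coe_inter] at hx
    have hne : (κ ∩ σ).Nonempty := by
      have := convexHull_nonempty_iff.1 ⟨x, hx⟩
      exact_mod_cast this
    have hρ := halfFaces_down_closed hκ Finset.inter_subset_left hne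
    have hρ' : κ ∩ σ ∈ halfFaces S (-μ) := by
      by_contra h
      exact hσ.2 (mem_halfFaces_of_star hA hS h4 C hsrc hρ h hσ.1 Finset.inter_subset_right)
    refine convexHull_mono ?_ (C.neg.halfFaces_inter hρ' hτ ⟨hx, hxτ⟩)
    rw [Finset.coe_inter]
    exact fun p hp => ⟨hp.1.2, hp.2⟩
  let T' : Complex :=
    { faces := (T.faces \ halfFaces S μ) ∪ halfFaces S (-μ)
      isRelLowerSet_faces := by
        rintro σ (hσ | hσ)
        · refine ⟨T.nonempty_of_mem_faces hσ.1, fun s hs hne => ?_⟩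
          have hsT := T.down_closed hσ.1 hs hne
          by_cases hsrc' : s ∈ halfFaces S μ
          · right
            by_contra h
            exact hσ.2 (mem_halfFaces_of_star hA hS h4 C hsrc hsrc' h hσ.1 hs)
          · exact Or.inl ⟨hsT, hsrc'⟩
        · exact ⟨hσ.1, fun s hs hne => Or.inr (halfFaces_down_closed hσ hs hne)⟩
      indep := by
        rintro σ (hσ | ⟨-, hσ, p, hp, -, hpσ⟩)
        · exact T.indep hσ.1
        · refine hA.affineIndependent (hσ.trans hS) ?_
          have := Finset.card_lt_card (hσ.ssubset_of_ne fun h => hpσ (h ▸ hp))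
          omega
      inter_subset_convexHull := by
        rintro σ τ (hσ | hσ) (hτ | hτ)
        · exact T.inter_subset_convexHull hσ.1 hτ.1
        · exact hmix hσ hτ
        · rw [Set.inter_comm, Set.inter_comm (σ : Set Plane)]
          exact hmix hτ hσ
        · exact C.neg.halfFaces_inter hσ hτ }
  have hfaces : ∀ σ ∈ T'.faces, σ ⊆ A := by
    rintro σ (hσ | hσ)
    exacts [hT.1 σ hσ.1, hσ.2.1.trans hS]
  refine ⟨T', ⟨hfaces, ?_⟩, rfl⟩
  refine Set.Subset.antisymm ?_ fun x hx => ?_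
  · intro x hx
    obtain ⟨σ, hσ, hx⟩ := T'.mem_space_iff.1 hx
    exact convexHull_mono (by exact_mod_cast hfaces σ hσ) hx
  · rw [← hT.2] at hx
    obtain ⟨σ, hσ, hx⟩ := T.mem_space_iff.1 hx
    rw [T'.mem_space_iff]
    by_cases hs : σ ∈ halfFaces S μ
    · obtain ⟨κ, hκ, hxκ⟩ := C.neg.exists_mem_halfFaces (x := x)
        (convexHull_mono (by exact_mod_cast hs.2.1) hx)
      exact ⟨κ, Or.inr hκ, hxκ⟩
    · exact ⟨σ, Or.inl ⟨hσ, hs⟩, hx⟩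

end IsTriangulation

/-! ### From local to global regularity. -/

theorem affineMap_apply_of_affine_coordinates {s : Finset Plane} {ν : Plane → ℝ} {y : Plane}
    (h1 : ∑ p ∈ s, ν p = 1) (hy : ∑ p ∈ s, ν p • p = y) (l : Plane →ᵃ[ℝ] ℝ) :
    l y = ∑ p ∈ s, ν p * l p := by
  rw [sum_mul_affineMap, h1, hy, one_mul]
  exact congrFun l.decomp y

/-- Tilting the supporting plane of `t` slightly down at the vertices outside `σ` leaves exactly `σ`
in contact. -/
theorem mem_lowerFaces_of_subset {A σ t : Finset Plane} {ω : Plane → ℝ} (hne : σ.Nonempty)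
    (hσ : σ ⊆ t) (htA : t ⊆ A) (hind : AffineIndependent ℝ ((↑) : t → Plane))
    {l : Plane →ᵃ[ℝ] ℝ} (hl : ∀ p ∈ t, l p = ω p) (hlt : ∀ p ∈ A, p ∉ t → l p < ω p) :
    σ ∈ lowerFaces ω A := by
  classical
  obtain ⟨m, hm⟩ := exists_affineMap_eqOn hind (fun p => if p ∈ σ then 0 else 1)
  obtain ⟨ε, h0, -, hε⟩ := exists_small_perturbation (A \ t) (fun p => ω p - l p) m (by
    intro p hp
    rw [Finset.mem_sdiff] at hp
    exact sub_pos.2 (hlt p hp.1 hp.2))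
  refine ⟨hne, hσ.trans htA, l - ε • m, fun p hp => ?_⟩
  have e : (l - ε • m) p = l p - ε * m p := by simp
  rw [e]
  by_cases hpt : p ∈ t
  · rw [hl p hpt, hm p hpt]
    by_cases hpσ : p ∈ σ
    · simp [hpσ]
    · simp [hpσ, h0.ne', h0.le]
  · have := hε p (Finset.mem_sdiff.2 ⟨hp, hpt⟩)
    exact ⟨by linarith, fun h => by linarith, fun h => absurd (hσ h) hpt⟩

namespace IsTriangulation

variable {A : Finset Plane} {T : Complex} {ω : Plane → ℝ}

/-- An interior point `x` of a lower face `σ` lies in some `τ` of `T`. The supporting planes of `σ`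
and `τ` agree at `x`, so the plane of `τ` touches the lift over all of `σ`, whence `σ ⊆ τ`. -/
theorem isRegularTriangulation_of_subset (hT : IsTriangulation A T)
    (h : T.faces ⊆ lowerFaces ω A) : IsRegularTriangulation A ω T := by
  refine ⟨hT, h.antisymm ?_⟩
  rintro σ ⟨hne, hσA, l, hl⟩
  obtain ⟨w, x, hw, hpos⟩ := exists_isWeight_pos hne
  have hx : x ∈ T.space := by
    rw [hT.2]
    exact convexHull_mono (by exact_mod_cast hσA) hw.mem_convexHull
  obtain ⟨τ, hτ, hxτ⟩ := T.mem_space_iff.1 hx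
  obtain ⟨w', hw'⟩ := mem_convexHull_iff_exists_isWeight.1 hxτ
  obtain ⟨-, hτA, l', hl'⟩ := h hτ
  refine T.down_closed hτ (fun p hp => ?_) hne
  have h1 : l x ≤ l' x := by
    rw [← hw'.sum_mul_affineMap l, ← hw'.sum_mul_affineMap l']
    refine Finset.sum_le_sum fun q hq => mul_le_mul_of_nonneg_left ?_ (hw'.1 q hq)
    rw [(hl' q (hτA hq)).2.2 hq]
    exact (hl q (hτA hq)).1
  have h2 : ∑ q ∈ σ, w q * (l q - l' q) = l x - l' x := by
    simp only [mul_sub]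
    rw [Finset.sum_sub_distrib, hw.sum_mul_affineMap, hw.sum_mul_affineMap]
  have h3 : ∀ q ∈ σ, 0 ≤ w q * (l q - l' q) := by
    intro q hq
    refine mul_nonneg (hw.1 q hq) (sub_nonneg.2 ?_)
    rw [(hl q (hσA hq)).2.2 hq]
    exact (hl' q (hσA hq)).1
  have h4 : w p * (l p - l' p) = 0 :=
    (Finset.sum_eq_zero_iff_of_nonneg h3).1 (le_antisymm (by linarith) (Finset.sum_nonneg h3)) p hp
  have h5 := (mul_eq_zero.1 h4).resolve_left (hpos p hp).ne'
  rw [← (hl' p (hσA hp)).2, ← (hl p (hσA hp)).2.2 hp]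
  linarith

theorem isRegularTriangulation_of_card_le_three (hT : IsTriangulation A T)
    (hA : InGeneralPosition A) (h3 : A.card ≤ 3) : IsRegularTriangulation A ω T := by
  refine hT.isRegularTriangulation_of_subset fun σ hσ => ?_
  have hind := hA.affineIndependent (Finset.Subset.refl A) h3
  obtain ⟨l, hl⟩ := exists_affineMap_eqOn hind ω
  exact mem_lowerFaces_of_subset (T.nonempty_of_mem_faces hσ) (hT.1 σ hσ) (Finset.Subset.refl A)
    hind hl fun p hp h => absurd hp h

/-- Some edge of `t` separates it from `p`. Local regularity across that edge says that the plane of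
the neighbouring triangle is strictly higher on the side of `p`. -/
theorem exists_triangle_lt (hT : IsTriangulation A T) (hω : IsGenericHeight A ω)
    (hv : ∀ v ∈ A, {v} ∈ T.faces)
    (hreg : ¬ ∃ e t₁ t₂, IsLocallyNonRegular .down ω T e t₁ t₂) {t : Finset Plane}
    (ht : t ∈ T.faces) (h3 : t.card = 3) {l : Plane →ᵃ[ℝ] ℝ} (hl : ∀ q ∈ t, l q = ω q)
    {p : Plane} (hp : p ∈ A) (hpt : p ∉ t) :
    ∃ t₂ ∈ T.faces, t₂.card = 3 ∧ ∀ l₂ : Plane →ᵃ[ℝ] ℝ, (∀ q ∈ t₂, l₂ q = ω q) → l p < l₂ p := by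
  classical
  have hind := T.indep ht
  obtain ⟨ν, hν, hνp⟩ := exists_affine_coordinates hind h3 p
  obtain ⟨q, hq, hνq⟩ : ∃ q ∈ t, ν q < 0 := by
    by_contra! hcon
    have hpt' : p ∈ convexHull ℝ (t : Set Plane) :=
      IsWeight.mem_convexHull ⟨hcon, hν, hνp⟩
    have hw : IsWeight {p} (fun _ => 1) p := ⟨by simp, by simp, by simp⟩
    exact hpt (subset_of_isWeight_pos (hv p hp) ht hw (by simp) hpt' (Finset.mem_singleton_self p))
  -- An affine function vanishing on the edge is determined by its value at `q`. Applied to `l₂ - l`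
  -- at `d` and at `p`, this transfers the sign from one to the other.
  have hsingle : ∀ (h : Plane →ᵃ[ℝ] ℝ), (∀ r ∈ t.erase q, h r = 0) → ∀ (ν : Plane → ℝ) (y : Plane),
      ∑ r ∈ t, ν r = 1 → ∑ r ∈ t, ν r • r = y → h y = ν q * h q := by
    intro h h0 ν y h1 hy
    rw [affineMap_apply_of_affine_coordinates h1 hy h, ← Finset.add_sum_erase t _ hq,
      Finset.sum_eq_zero fun r hr => by rw [h0 r hr, mul_zero], add_zero]
  obtain ⟨g, hg⟩ := exists_affineMap_eqOn hind (fun r => if r = q then 1 else 0)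
  have hgq : g q = 1 := by simp [hg q hq]
  have hge : ∀ r ∈ t.erase q, g r = 0 := fun r hr => by
    rw [hg r (Finset.mem_of_mem_erase hr), if_neg (Finset.ne_of_mem_erase hr)]
  have hgp : g p < 0 := by rw [hsingle g hge ν p hν hνp, hgq, mul_one]; exact hνq
  have hecard : (t.erase q).card = 2 := by rw [Finset.card_erase_of_mem hq, h3]
  have he : t.erase q ∈ T.faces := T.down_closed ht (Finset.erase_subset _ _)
    (Finset.card_pos.1 (by omega))
  obtain ⟨d, hgd, hd⟩ := hT.exists_neighbor he hge hp hgp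
  have hdA : d ∈ A := hT.1 _ hd (Finset.mem_insert_self _ _)
  have hdt : d ∉ t := by
    intro h
    rw [hg d h] at hgd
    split_ifs at hgd <;> linarith
  have hde : d ∉ t.erase q := fun h => hdt (Finset.mem_of_mem_erase h)
  have hcard : (insert d (t.erase q)).card = 3 := by rw [Finset.card_insert_of_notMem hde, hecard]
  have hne : t ≠ insert d (t.erase q) := fun h => hdt (h ▸ Finset.mem_insert_self _ _)
  have hle : ¬ ω d < l d := by
    intro hlt
    refine hreg ⟨t.erase q, t, insert d (t.erase q), hecard, ht, h3, Finset.erase_subset _ _, hd,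
      hcard, Finset.subset_insert _ _, hne, l, hl, fun r hr hrt => ?_⟩
    rcases Finset.mem_insert.1 hr with rfl | h
    · exact hlt
    · exact absurd (Finset.mem_of_mem_erase h) hrt
  have hned : l d ≠ ω d := by
    intro h
    refine hω (insert d t) (Finset.insert_subset hdA (hT.1 t ht))
      (by rw [Finset.card_insert_of_notMem hdt, h3]) ⟨l, fun r hr => ?_⟩
    rcases Finset.mem_insert.1 hr with rfl | h'
    exacts [h, hl r h']
  have hlt : l d < ω d := lt_of_le_of_ne (not_lt.1 hle) hned
  refine ⟨_, hd, hcard, fun l₂ hl₂ => ?_⟩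
  obtain ⟨ν', hν', hνd⟩ := exists_affine_coordinates hind h3 d
  have hdiff : ∀ r ∈ t.erase q, (l₂ - l) r = 0 := by
    intro r hr
    simp [hl₂ r (Finset.mem_insert_of_mem hr), hl r (Finset.mem_of_mem_erase hr)]
  have e1 := hsingle (l₂ - l) hdiff ν p hν hνp
  have e2 := hsingle (l₂ - l) hdiff ν' d hν' hνd
  have e3 := hsingle g hge ν' d hν' hνd
  rw [hgq, mul_one] at e3
  simp only [AffineMap.coe_sub, Pi.sub_apply] at e1 e2
  rw [hl₂ d (Finset.mem_insert_self _ _)] at e2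
  have h6 : l₂ q - l q < 0 := by
    by_contra hcon
    have := mul_nonpos_of_nonpos_of_nonneg (e3 ▸ hgd).le (not_lt.1 hcon)
    linarith
  have := mul_pos_of_neg_of_neg hνq h6
  linarith

theorem isRegularTriangulation (hT : IsTriangulation A T) (hA : InGeneralPosition A)
    (hω : IsGenericHeight A ω) (hv : ∀ v ∈ A, {v} ∈ T.faces)
    (hreg : ¬ ∃ e t₁ t₂, IsLocallyNonRegular .down ω T e t₁ t₂) :
    IsRegularTriangulation A ω T := by
  rcases le_total A.card 3 with h3 | h3
  · exact hT.isRegularTriangulation_of_card_le_three hA h3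
  have hex : ∀ t : Finset Plane, ∃ l : Plane →ᵃ[ℝ] ℝ, t ∈ T.faces → ∀ q ∈ t, l q = ω q := by
    intro t
    by_cases ht : t ∈ T.faces
    · obtain ⟨l, hl⟩ := exists_affineMap_eqOn (T.indep ht) ω
      exact ⟨l, fun _ => hl⟩
    · exact ⟨0, fun h => absurd h ht⟩
  choose L hL using hex
  refine hT.isRegularTriangulation_of_subset fun σ hσ => ?_
  obtain ⟨t, ht, hσt, htc⟩ := hT.exists_triangle hA hσ h3
  refine mem_lowerFaces_of_subset (T.nonempty_of_mem_faces hσ) hσt (hT.1 t ht) (T.indep ht)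
    (hL t ht) fun p hp hpt => ?_
  -- Instead of walking towards `p`, take the triangle whose plane is highest over `p`: by
  -- `exists_triangle_lt` it must have `p` as a vertex, so the maximum is `ω p`.
  obtain ⟨m, ⟨hm, hmc⟩, hmax⟩ := Set.exists_max_image {s | s ∈ T.faces ∧ s.card = 3}
    (fun s => L s p) (hT.finite_faces.subset fun _ h => h.1) ⟨t, ht, htc⟩
  have hpm : p ∈ m := by
    by_contra hpm
    obtain ⟨t₂, ht₂, hc₂, hlt⟩ := hT.exists_triangle_lt hω hv hreg hm hmc (hL m hm) hp hpm
    exact absurd (hlt _ (hL t₂ ht₂)) (not_lt.2 (hmax t₂ ⟨ht₂, hc₂⟩))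
  obtain ⟨t₂, ht₂, hc₂, hlt⟩ := hT.exists_triangle_lt hω hv hreg ht htc (hL t ht) hp hpt
  calc L t p < L t₂ p := hlt _ (hL t₂ ht₂)
    _ ≤ L m p := hmax t₂ ⟨ht₂, hc₂⟩
    _ = ω p := hL m hm p hpm

end IsTriangulation

/-! ### Convex heights: the required flips exist. -/

/-- If `v` were the only positive point, it would be a convex combination of the others with weights
`-μ p / μ v`, and Jensen's inequality would contradict the sign of the height sum. -/
theorem IsConvexHeight.exists_pos_ne {A S : Finset Plane} {ω μ : Plane → ℝ}
    (h : IsConvexHeight A ω) (hS : S ⊆ A) (C : IsCircuit S μ) (hD : 0 < ∑ p ∈ S, μ p * ω p)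
    {v : Plane} (hv : v ∈ S) : ∃ p ∈ S, p ≠ v ∧ 0 < μ p := by
  classical
  obtain ⟨g, hg, hgω⟩ := h
  by_contra! hcon
  have hμv : 0 < μ v := by
    obtain ⟨p, hp, hμ⟩ := C.exists_pos
    by_cases hpv : p = v
    · exact hpv ▸ hμ
    · exact absurd (hcon p hp hpv) (not_le.2 hμ)
  have h0 := C.sum_eq_zero
  have h1 := C.sum_smul_eq_zero
  rw [← Finset.add_sum_erase S _ hv] at h0 h1 hD
  have hJ := hg.map_sum_le (t := S.erase v) (w := fun p => -(μ v)⁻¹ * μ p) (p := fun p => p)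
    (fun p hp => by
      have := hcon p (Finset.mem_of_mem_erase hp) (Finset.ne_of_mem_erase hp)
      rw [neg_mul, ← mul_neg]
      exact mul_nonneg (inv_nonneg.2 hμv.le) (neg_nonneg.2 this))
    (by
      rw [← Finset.mul_sum, eq_neg_of_add_eq_zero_right h0]
      field_simp)
    (fun p hp => subset_convexHull ℝ _ (Finset.mem_coe.2 (hS (Finset.mem_of_mem_erase hp))))
  simp only [mul_smul, ← Finset.smul_sum] at hJ
  rw [eq_neg_of_add_eq_zero_right h1, smul_neg, neg_smul, neg_neg, smul_smul,
    inv_mul_cancel₀ hμv.ne', one_smul, hgω v (hS hv)] at hJ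
  have e : ∑ p ∈ S.erase v, μ p • g p = ∑ p ∈ S.erase v, μ p * ω p :=
    Finset.sum_congr rfl fun p hp => by
      rw [smul_eq_mul, hgω p (hS (Finset.mem_of_mem_erase hp))]
  rw [e, smul_eq_mul] at hJ
  have := mul_le_mul_of_nonneg_left hJ hμv.le
  rw [← mul_assoc, mul_neg, mul_inv_cancel₀ hμv.ne'] at this
  linarith

namespace IsTriangulation

variable {A S : Finset Plane} {T : Complex} {ω μ : Plane → ℝ}

theorem exists_isFlipOn_down (hT : IsTriangulation A T) (hA : InGeneralPosition A) (hS : S ⊆ A)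
    (h4 : S.card = 4) (C : IsCircuit S μ) (hD : 0 < ∑ p ∈ S, μ p * ω p)
    (hsrc : halfFaces S (-μ) ⊆ T.faces) :
    ∃ T', IsFlipOn .down A ω S T T' ∧ halfFaces S μ ⊆ T'.faces := by
  obtain ⟨T', hT', hfaces⟩ := hT.exists_exchange hA hS h4 C.neg hsrc
  have hind := fun q hq => hA.affineIndependent_erase (q := q) hS h4 hq
  rw [neg_neg] at hfaces
  refine ⟨T', ⟨hT, hT', hS, h4, ?_, ?_⟩, ?_⟩
  · rw [sourceFaces, C.upperFaces_eq hD hind]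
    exact hsrc
  · rw [sourceFaces, targetFaces, C.upperFaces_eq hD hind, C.lowerFaces_eq hD hind]
    exact hfaces
  · rw [hfaces]
    exact Set.subset_union_right

/-- The vertex `d` is negative since it lies below the plane of `t₁`, and `c` is negative since the
two triangles lie on opposite sides of `e`. At least two points are positive, so these are the ends
of `e`, and the upper faces over `S` are faces of `t₁` or `t₂`. -/
theorem exists_isEdgeFlip_down (hT : IsTriangulation A T) (hA : InGeneralPosition A)
    (hω : IsGenericHeight A ω) (hconv : IsConvexHeight A ω) {e t₁ t₂ : Finset Plane}
    (h : IsLocallyNonRegular .down ω T e t₁ t₂) :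
    ∃ S T', IsEdgeFlip .down A ω e S T T' := by
  classical
  have h' := h
  obtain ⟨he, ht₁, h3, he₁, ht₂, h3', he₂, hne, l, hl, hbey⟩ := h
  obtain ⟨c, hce, hc⟩ := Finset.exists_eq_insert_iff.2 ⟨he₁, by omega⟩
  obtain ⟨d, hde, hd⟩ := Finset.exists_eq_insert_iff.2 ⟨he₂, by omega⟩
  have hd₂ : d ∈ t₂ := hd ▸ Finset.mem_insert_self _ _
  have hc₁ : c ∈ t₁ := hc ▸ Finset.mem_insert_self _ _
  have hcd : c ≠ d := fun hcd => hne (by rw [← hc, ← hd, hcd])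
  have hd₁ : d ∉ t₁ := by
    rw [← hc, Finset.mem_insert, not_or]
    exact ⟨hcd.symm, hde⟩
  have hc₂ : c ∉ t₂ := by
    rw [← hd, Finset.mem_insert, not_or]
    exact ⟨hcd, hce⟩
  have hdl : ω d < l d := hbey d hd₂ hd₁
  set S := insert d t₁ with hSdef
  have ht₁S : t₁ ⊆ S := Finset.subset_insert _ _
  have ht₂S : t₂ ⊆ S := by
    rw [← hd]
    exact Finset.insert_subset_insert d he₁
  have hmemS : ∀ p ∈ S, p = c ∨ p = d ∨ p ∈ e := by
    intro p hp
    rw [hSdef, ← hc, Finset.mem_insert, Finset.mem_insert] at hp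
    tauto
  have hSA : S ⊆ A := Finset.insert_subset (hT.1 _ ht₂ hd₂) (hT.1 _ ht₁)
  have h4 : S.card = 4 := by rw [hSdef, Finset.card_insert_of_notMem hd₁, h3]
  obtain ⟨μ, C, hD⟩ := hA.exists_isCircuit hω hSA h4
  have hdS : d ∈ S := Finset.mem_insert_self _ _
  have hμd : μ d < 0 := by
    have h0 : ∑ p ∈ S, μ p * (ω p - l p) = ∑ p ∈ S, μ p * ω p := by
      simp only [mul_sub]
      rw [Finset.sum_sub_distrib, C.sum_mul_affineMap, sub_zero]
    rw [hSdef, Finset.sum_insert hd₁, Finset.sum_eq_zero fun p hp => by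
      rw [hl p hp, sub_self, mul_zero], add_zero] at h0
    by_contra hcon
    have := mul_nonpos_of_nonneg_of_nonpos (not_lt.1 hcon) (sub_neg.2 hdl).le
    linarith
  have hμc : μ c < 0 := by
    refine lt_of_le_of_ne (not_lt.1 fun hcpos => ?_) (C.ne_zero c (ht₁S hc₁))
    -- If `μ c` were positive, give `c` the weight `ε * μ c` and share the rest equally over `e`.
    -- Subtracting `ε * μ` cancels the weight at `c`, so an interior point of `t₁` would lie in
    -- `t₂`.
    obtain ⟨ε, h0, -, hε⟩ := exists_small_perturbation S (fun _ => 1 / 2)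
      (fun p => -μ c / 2 - |μ p|) (fun _ _ => by norm_num)
    have hε' : ∀ p ∈ S, ε * |μ p| < (1 - ε * μ c) / 2 := fun p hp => by
      have := hε p hp
      linarith
    have hhalf : 0 < (1 - ε * μ c) / 2 :=
      lt_of_le_of_lt (mul_nonneg h0.le (abs_nonneg _)) (hε' d hdS)
    have hwpos : ∀ p ∈ t₁, 0 < (if p = c then ε * μ c else (1 - ε * μ c) / 2) := by
      intro p _
      split_ifs
      exacts [mul_pos h0 hcpos, hhalf]
    obtain ⟨x, hw⟩ :
        ∃ x, IsWeight t₁ (fun p => if p = c then ε * μ c else (1 - ε * μ c) / 2) x := by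
      refine ⟨_, fun p hp => (hwpos p hp).le, ?_, rfl⟩
      rw [← hc, Finset.sum_insert hce, if_pos rfl,
        Finset.sum_congr rfl fun p hp => if_neg (ne_of_mem_of_not_mem hp hce),
        Finset.sum_const, he, nsmul_eq_mul]
      push_cast
      ring
    have hsub := C.isWeight_sub (hw.extend ht₁S) ε (by
      intro p hp
      rcases hmemS p hp with rfl | rfl | hpe
      · simp [hc₁]
      · rw [if_neg hd₁]
        have := mul_neg_of_pos_of_neg h0 hμd
        linarith
      · rw [if_pos (he₁ hpe), if_neg (ne_of_mem_of_not_mem hpe hce)]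
        have := mul_le_mul_of_nonneg_left (le_abs_self (μ p)) h0.le
        have := hε' p hp
        linarith)
    have hw₂ := (hsub.restrict ht₂S (by
      intro p hp hp₂
      rcases hmemS p hp with rfl | rfl | hpe
      · simp [hc₁]
      · exact absurd hd₂ hp₂
      · exact absurd (he₂ hpe) hp₂)).mem_convexHull
    exact hc₂ (subset_of_isWeight_pos ht₁ ht₂ hw hwpos hw₂ hc₁)
  have hμe : ∀ p ∈ e, 0 < μ p := by
    intro p hp
    -- `r` is the other end of `e`; a positive point different from `r` can only be `p`.
    obtain ⟨r, hre, hr⟩ : ∃ r ∈ e, ∀ q ∈ e, q ≠ r → q = p := by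
      obtain ⟨a, b, -, rfl⟩ := Finset.card_eq_two.1 he
      rcases Finset.mem_insert.1 hp with rfl | hp
      · exact ⟨b, by simp, by simp⟩
      · rw [Finset.mem_singleton] at hp
        subst hp
        exact ⟨a, by simp, by simp⟩
    obtain ⟨q, hq, hqr, hμq⟩ := hconv.exists_pos_ne hSA C hD (ht₁S (he₁ hre))
    rcases hmemS q hq with rfl | rfl | hqe
    · exact absurd hμq hμc.not_gt
    · exact absurd hμq hμd.not_gt
    · exact hr q hqe hqr ▸ hμq
  obtain ⟨T', hflip, -⟩ := hT.exists_isFlipOn_down hA hSA h4 C hD (by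
    rintro σ ⟨hσne, hσ, p, hp, hμp, hpσ⟩
    simp only [Pi.neg_apply, Left.neg_pos_iff] at hμp
    rcases hmemS p hp with rfl | rfl | hpe
    · refine T.down_closed ht₂ (fun q hq => ?_) hσne
      rcases hmemS q (hσ hq) with rfl | rfl | hqe
      exacts [absurd hq hpσ, hd₂, he₂ hqe]
    · refine T.down_closed ht₁ (fun q hq => ?_) hσne
      rcases hmemS q (hσ hq) with rfl | rfl | hqe
      exacts [hc₁, absurd hq hpσ, he₁ hqe]
    · exact absurd hμp (hμe p hpe).not_gt)
  refine ⟨S, T', t₁, t₂, h', ?_, hflip⟩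
  rw [← Finset.coe_union]
  congr 1
  refine Finset.Subset.antisymm (Finset.insert_subset (Finset.mem_union_right _ hd₂)
    Finset.subset_union_left) (Finset.union_subset ht₁S ht₂S)

theorem exists_isVertexInsertion_down (hT : IsTriangulation A T) (hA : InGeneralPosition A)
    (hω : IsGenericHeight A ω) (hconv : IsConvexHeight A ω) (h3 : 3 ≤ A.card) {v : Plane}
    (hv : v ∈ A) (hvT : {v} ∉ T.faces) : ∃ S T', IsVertexInsertion .down A ω v S T T' := by
  classical
  have hx : v ∈ T.space := by
    rw [hT.2]
    exact subset_convexHull ℝ _ (Finset.mem_coe.2 hv)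
  obtain ⟨τ, hτ, hvτ⟩ := T.mem_space_iff.1 hx
  obtain ⟨t, ht, hτt, htc⟩ := hT.exists_triangle hA hτ h3
  obtain ⟨w, hw⟩ := mem_convexHull_iff_exists_isWeight.1
    (convexHull_mono (Finset.coe_subset.2 hτt) hvτ)
  have hvt : v ∉ t := fun h => hvT
    (T.down_closed ht (Finset.singleton_subset_iff.2 h) (Finset.singleton_nonempty v))
  have hSA : insert v t ⊆ A := Finset.insert_subset hv (hT.1 t ht)
  have h4 : (insert v t).card = 4 := by rw [Finset.card_insert_of_notMem hvt, htc]
  obtain ⟨μ, C, hD⟩ := hA.exists_isCircuit hω hSA h4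
  have hvS : v ∈ insert v t := Finset.mem_insert_self _ _
  have hwt : ∀ p ∈ t, (if p = v then -1 else w p) = w p :=
    fun p hp => if_neg (ne_of_mem_of_not_mem hp hvt)
  -- The coordinates of `v` in `t`, with `-1` at `v`, are a multiple of `μ`. Convexity makes the
  -- factor positive, so `v` is the only negative point and the upper faces are those of `t`.
  obtain ⟨s, hs⟩ := C.unique (fun p => if p = v then -1 else w p)
    (by rw [Finset.sum_insert hvt, if_pos rfl, Finset.sum_congr rfl hwt, hw.2.1]; ring)
    (by
      rw [Finset.sum_insert hvt, if_pos rfl,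
        Finset.sum_congr rfl fun p hp => by rw [hwt p hp], hw.2.2]
      simp)
  have hsv : -1 = s * μ v := by simpa using hs v hvS
  have hst : ∀ p ∈ t, w p = s * μ p := fun p hp => by
    rw [← hs p (Finset.mem_insert_of_mem hp)]
    exact (hwt p hp).symm
  obtain ⟨q, hq, hqv, hμq⟩ := hconv.exists_pos_ne hSA C hD hvS
  have hqt : q ∈ t := (Finset.mem_insert.1 hq).resolve_left hqv
  have hs0 : 0 < s := by
    refine lt_of_le_of_ne ?_ (by rintro rfl; simp at hsv)
    by_contra hcon
    have h1 := mul_neg_of_neg_of_pos (not_le.1 hcon) hμq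
    have h2 := hw.1 q hqt
    rw [hst q hqt] at h2
    linarith
  have hμt : ∀ p ∈ t, 0 ≤ μ p := by
    intro p hp
    have h2 := hw.1 p hp
    rw [hst p hp] at h2
    exact nonneg_of_mul_nonneg_right h2 hs0
  obtain ⟨T', hflip, htgt⟩ := hT.exists_isFlipOn_down hA hSA h4 C hD (by
    rintro σ ⟨hσne, hσ, p, hp, hμp, hpσ⟩
    simp only [Pi.neg_apply, Left.neg_pos_iff] at hμp
    rcases Finset.mem_insert.1 hp with rfl | hpt
    · refine T.down_closed ht (fun r hr => ?_) hσne
      exact (Finset.mem_insert.1 (hσ hr)).resolve_left (ne_of_mem_of_not_mem hr hpσ)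
    · exact absurd hμp (hμt p hpt).not_gt)
  refine ⟨insert v t, T', hv, hvT, htgt ⟨Finset.singleton_nonempty v,
    Finset.singleton_subset_iff.2 hvS, q, hq, hμq, ?_⟩, hflip⟩
  rwa [Finset.mem_singleton]

theorem isRegularTriangulation_of_isConvexHeight (hT : IsTriangulation A T)
    (hA : InGeneralPosition A) (hω : IsGenericHeight A ω) (hconv : IsConvexHeight A ω)
    (hins : ¬ ∃ v S T', IsVertexInsertion .down A ω v S T T')
    (hreg : ¬ ∃ e t₁ t₂, IsLocallyNonRegular .down ω T e t₁ t₂) :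
    IsRegularTriangulation A ω T := by
  rcases le_total A.card 3 with h3 | h3
  · exact hT.isRegularTriangulation_of_card_le_three hA h3
  refine hT.isRegularTriangulation hA hω (fun v hv => ?_) hreg
  by_contra hvT
  obtain ⟨S, T', h⟩ := hT.exists_isVertexInsertion_down hA hω hconv h3 hv hvT
  exact hins ⟨v, S, T', h⟩

end IsTriangulation

/-! ### Termination: the lifted surface descends. -/

/-- The surface formed by the lifted simplices of `F` passes through the point of height `z`
over `x`. -/
def HasHeight (ω : Plane → ℝ) (F : Set (Finset Plane)) (x : Plane) (z : ℝ) : Prop :=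
  ∃ σ ∈ F, ∃ w, IsWeight σ w x ∧ ∑ p ∈ σ, w p * ω p = z

theorem HasHeight.mono {ω : Plane → ℝ} {F G : Set (Finset Plane)} {x : Plane} {z : ℝ}
    (h : HasHeight ω F x z) (hFG : F ⊆ G) : HasHeight ω G x z := by
  obtain ⟨σ, hσ, h⟩ := h
  exact ⟨σ, hFG hσ, h⟩

/-- In any face through `x`, the coordinates of `x` are supported on the intersection of the two
faces, so both heights are computed there. -/
theorem HasHeight.unique {ω : Plane → ℝ} {T : Complex} {x : Plane} {z z' : ℝ}
    (h : HasHeight ω T.faces x z) (h' : HasHeight ω T.faces x z') : z = z' := by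
  classical
  obtain ⟨σ, hσ, w, hw, rfl⟩ := h
  obtain ⟨τ, hτ, w', hw', rfl⟩ := h'
  have hx := T.inter_subset_convexHull hσ hτ ⟨hw.mem_convexHull, hw'.mem_convexHull⟩
  rw [← Finset.coe_inter] at hx
  obtain ⟨u, hu⟩ := mem_convexHull_iff_exists_isWeight.1 hx
  have key : ∀ {ρ : Finset Plane} {v : Plane → ℝ}, ρ ∈ T.faces → IsWeight ρ v x → σ ∩ τ ⊆ ρ →
      ∑ p ∈ ρ, v p * ω p = ∑ p ∈ σ ∩ τ, u p * ω p := by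
    intro ρ v hρ hv hsub
    have e := hv.eq_of_affineIndependent (T.indep hρ) (hu.extend hsub)
    rw [← Finset.sum_subset hsub fun p hp hpn => by rw [e p hp, if_neg hpn, zero_mul]]
    exact Finset.sum_congr rfl fun p hp => by rw [e p (hsub hp), if_pos hp]
  rw [key hσ hw Finset.inter_subset_left, key hτ hw' Finset.inter_subset_right]

theorem IsCircuit.exists_hasHeight {S : Finset Plane} {μ ω w : Plane → ℝ} {x : Plane}
    (C : IsCircuit S μ) (hw : IsWeight S w x) : ∃ t : ℝ, 0 ≤ t ∧ ((∀ p ∈ S, 0 < w p) → 0 < t) ∧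
      HasHeight ω (halfFaces S μ) x (∑ p ∈ S, w p * ω p - t * ∑ p ∈ S, μ p * ω p) := by
  obtain ⟨t, ht, σ, hσ, hwσ, h0⟩ := C.exists_isWeight_halfFaces hw
  refine ⟨t, ht, fun hpos => ?_, σ, hσ, _, hwσ, ?_⟩
  · obtain ⟨-, -, p, hp, hμ, hpσ⟩ := hσ
    refine lt_of_le_of_ne ht ?_
    rintro rfl
    have := h0 p hp hpσ
    have := hpos p hp
    linarith
  · rw [Finset.sum_subset hσ.2.1 fun p hp hpn => by rw [h0 p hp hpn, zero_mul], Finset.mul_sum,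
      ← Finset.sum_sub_distrib]
    exact Finset.sum_congr rfl fun p _ => by ring

/-- Somewhere the lifted triangulation `T` runs strictly below the upper faces of the lifted
tetrahedron over `S`. -/
def IsBelowUpperFaces (ω : Plane → ℝ) (T : Complex) (S : Finset Plane) : Prop :=
  ∃ x z z', HasHeight ω T.faces x z ∧ HasHeight ω (upperFaces ω S) x z' ∧ z < z'

open Classical in
/-- The number of supports whose upper faces the lifted triangulation `T` has not yet passed. -/
noncomputable def flipRank (A : Finset Plane) (ω : Plane → ℝ) (T : Complex) : ℕ :=
  ((A.powersetCard 4).filter fun S => ¬ IsBelowUpperFaces ω T S).card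

section

variable {A S : Finset Plane} {ω : Plane → ℝ} {T T' : Complex}

theorem IsFlipOn.exists_isCircuit (h : IsFlipOn .down A ω S T T') (hA : InGeneralPosition A)
    (hω : IsGenericHeight A ω) : ∃ μ, IsCircuit S μ ∧ 0 < ∑ p ∈ S, μ p * ω p ∧
      upperFaces ω S = halfFaces S (-μ) ∧ lowerFaces ω S = halfFaces S μ ∧
      halfFaces S (-μ) ⊆ T.faces ∧
      T'.faces = (T.faces \ halfFaces S (-μ)) ∪ halfFaces S μ := by
  obtain ⟨-, -, hS, h4, hsrc, hfaces⟩ := h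
  obtain ⟨μ, C, hD⟩ := hA.exists_isCircuit hω hS h4
  have hind := fun q hq => hA.affineIndependent_erase (q := q) hS h4 hq
  have hu := C.upperFaces_eq hD hind
  have hl := C.lowerFaces_eq hD hind
  rw [sourceFaces, hu] at hsrc
  rw [sourceFaces, targetFaces, hu, hl] at hfaces
  exact ⟨μ, C, hD, hu, hl, hsrc, hfaces⟩

theorem IsFlipOn.exists_hasHeight_le (h : IsFlipOn .down A ω S T T') (hA : InGeneralPosition A)
    (hω : IsGenericHeight A ω) {x : Plane} {z : ℝ} (hz : HasHeight ω T.faces x z) :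
    ∃ z' ≤ z, HasHeight ω T'.faces x z' := by
  classical
  obtain ⟨μ, C, hD, -, -, -, hfaces⟩ := h.exists_isCircuit hA hω
  obtain ⟨σ, hσ, w, hw, rfl⟩ := hz
  by_cases hs : σ ∈ halfFaces S (-μ)
  · obtain ⟨t, ht, -, hH⟩ := C.exists_hasHeight (ω := ω) (hw.extend hs.2.1)
    refine ⟨_, ?_, hH.mono (hfaces ▸ Set.subset_union_right)⟩
    have e : ∑ p ∈ S, (if p ∈ σ then w p else 0) * ω p = ∑ p ∈ σ, w p * ω p := by
      rw [← Finset.sum_subset hs.2.1 fun p _ hpn => by rw [if_neg hpn, zero_mul]]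
      exact Finset.sum_congr rfl fun p hp => by rw [if_pos hp]
    rw [e]
    exact sub_le_self _ (mul_nonneg ht hD.le)
  · exact ⟨_, le_rfl, σ, hfaces ▸ Or.inl ⟨hσ, hs⟩, w, hw, rfl⟩

theorem IsFlipOn.isBelowUpperFaces (h : IsFlipOn .down A ω S T T') (hA : InGeneralPosition A)
    (hω : IsGenericHeight A ω) : IsBelowUpperFaces ω T' S := by
  obtain ⟨μ, C, hD, hu, -, -, hfaces⟩ := h.exists_isCircuit hA hω
  -- At a point with all four weights positive, the slide to the lower faces has positive length, so
  -- the gap between lower and upper faces is strict.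
  obtain ⟨w, x, hw, hpos⟩ := exists_isWeight_pos C.nonempty
  obtain ⟨t, -, ht, hH⟩ := C.exists_hasHeight (ω := ω) hw
  obtain ⟨t', ht', -, hH'⟩ := C.neg.exists_hasHeight (ω := ω) hw
  refine ⟨x, _, _, hH.mono (hfaces ▸ Set.subset_union_right), hu ▸ hH', ?_⟩
  have h1 := mul_pos (ht hpos) hD
  have h2 := mul_nonneg ht' hD.le
  simp only [Pi.neg_apply, neg_mul, Finset.sum_neg_distrib, mul_neg]
  linarith

/-- Having passed below some upper faces is preserved by the descent of the surface. `S` itself is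
new: before the flip the surface coincides with its upper faces. -/
theorem IsFlipOn.flipRank_lt (h : IsFlipOn .down A ω S T T') (hA : InGeneralPosition A)
    (hω : IsGenericHeight A ω) : flipRank A ω T' < flipRank A ω T := by
  classical
  refine Finset.card_lt_card (Finset.ssubset_iff_of_subset ?_ |>.2 ⟨S, ?_, ?_⟩)
  · refine Finset.monotone_filter_right _ fun R _ => mt ?_
    rintro ⟨x, z, z', hz, hz', hlt⟩
    obtain ⟨y, hy, hH⟩ := h.exists_hasHeight_le hA hω hz
    exact ⟨x, y, z', hH, hz', hy.trans_lt hlt⟩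
  · rw [Finset.mem_filter, Finset.mem_powersetCard]
    refine ⟨⟨h.2.2.1, h.2.2.2.1⟩, ?_⟩
    rintro ⟨x, z, z', hz, hz', hlt⟩
    exact hlt.ne (hz.unique (hz'.mono h.2.2.2.2.1))
  · rw [Finset.mem_filter, not_and_not_right]
    exact fun _ => h.isBelowUpperFaces hA hω

theorem IsDirectedFlip.terminatesIn_down (hA : InGeneralPosition A) (hω : IsGenericHeight A ω)
    (hconv : IsConvexHeight A ω) (hT : IsTriangulation A T) :
    TerminatesIn (IsDirectedFlip .down A ω) T (IsRegularTriangulation A ω) := by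
  constructor
  · rintro ⟨f, -, hf⟩
    obtain ⟨n, hn⟩ := WellFounded.not_rel_apply_succ (r := (· < ·))
      (fun n => flipRank A ω (f n))
    obtain ⟨S, hS⟩ := hf n
    exact hn (hS.flipRank_lt hA hω)
  · intro s hs hfinal
    have hTs : IsTriangulation A s := by
      rcases Relation.ReflTransGen.cases_tail hs with rfl | ⟨_, -, _, h⟩
      exacts [hT, h.2.1]
    refine hTs.isRegularTriangulation_of_isConvexHeight hA hω hconv ?_ ?_
    · rintro ⟨v, S, T', -, -, -, h⟩
      exact hfinal T' ⟨S, h⟩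
    · rintro ⟨e, t₁, t₂, h⟩
      obtain ⟨S, T', -, -, -, -, h⟩ := hTs.exists_isEdgeFlip_down hA hω hconv h
      exact hfinal T' ⟨S, h⟩

end

/-! ### The stack invariant of Lawson's algorithm. -/

/-- The two points off `f` have coefficients of opposite sign, so by the dependency an affine
function vanishing on `f` has the same sign at both. -/
theorem isHullEdge_of_mem_halfFaces {A S f : Finset Plane} {μ : Plane → ℝ}
    (hA : InGeneralPosition A) (hS : S ⊆ A) (h4 : S.card = 4) (C : IsCircuit S μ)
    (h2 : f.card = 2) (hf : f ∈ halfFaces S μ) (hf' : f ∈ halfFaces S (-μ)) :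
    IsHullEdge S f := by
  classical
  obtain ⟨-, hfS, r, hr, hμr, hrf⟩ := hf
  obtain ⟨-, -, s, hs, hμs, hsf⟩ := hf'
  simp only [Pi.neg_apply, Left.neg_pos_iff] at hμs
  have hsr : s ≠ r := by
    rintro rfl
    linarith
  have hs' : s ∉ insert r f := by
    rw [Finset.mem_insert, not_or]
    exact ⟨hsr, hsf⟩
  have hSeq : insert s (insert r f) = S := by
    refine Finset.eq_of_subset_of_card_le
      (Finset.insert_subset hs (Finset.insert_subset hr hfS)) ?_
    rw [Finset.card_insert_of_notMem hs', Finset.card_insert_of_notMem hrf, h2, h4]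
  obtain ⟨g, hg⟩ := exists_affineMap_eqOn (hA.affineIndependent_erase hS h4 hs)
    (fun p => if p = r then 1 else 0)
  rw [← hSeq, Finset.erase_insert hs'] at hg
  have hgr : g r = 1 := by simp [hg r (Finset.mem_insert_self _ _)]
  have hgf : ∀ p ∈ f, g p = 0 := fun p hp => by
    rw [hg p (Finset.mem_insert_of_mem hp), if_neg (ne_of_mem_of_not_mem hp hrf)]
  have hsum := C.sum_mul_affineMap g
  rw [← hSeq, Finset.sum_insert hs', Finset.sum_insert hrf,
    Finset.sum_eq_zero fun p hp => by rw [hgf p hp, mul_zero], hgr] at hsum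
  have hgs : 0 < g s := by
    by_contra hcon
    have := mul_nonneg_of_nonpos_of_nonpos hμs.le (not_lt.1 hcon)
    linarith
  refine ⟨hfS, h2, g, fun p hp => ?_⟩
  rw [← hSeq, Finset.mem_insert, Finset.mem_insert] at hp
  rcases hp with rfl | rfl | hp
  · exact ⟨hgs.le, fun h => absurd h hgs.ne', fun h => absurd h hsf⟩
  · rw [hgr]
    exact ⟨zero_le_one, fun h => absurd h one_ne_zero, fun h => absurd h hrf⟩
  · rw [hgf p hp]
    exact ⟨le_rfl, fun _ => hp, fun _ => rfl⟩

theorem exists_listsHullEdges (S : Finset Plane) : ∃ N, ListsHullEdges S N := by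
  classical
  refine ⟨(S.powerset.filter (IsHullEdge S)).toList, Finset.nodup_toList _, fun e => ?_⟩
  rw [Finset.mem_toList, Finset.mem_filter, Finset.mem_powerset]
  exact ⟨fun h => h.2, fun h => ⟨h.1, h⟩⟩

section

variable {A S : Finset Plane} {ω : Plane → ℝ} {T T' : Complex}

/-- A new edge interior to `conv S` has both its triangles among the lower faces over `S`, so it is
locally regular. A new edge that also belongs to the old half is a hull edge, and any other edge
keeps its two triangles. -/
theorem IsLocallyNonRegular.of_isFlipOn {f t₁ t₂ : Finset Plane}
    (hf : IsLocallyNonRegular .down ω T' f t₁ t₂) (h : IsFlipOn .down A ω S T T')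
    (hA : InGeneralPosition A) (hω : IsGenericHeight A ω) :
    IsHullEdge S f ∨ IsLocallyNonRegular .down ω T f t₁ t₂ ∧ f ∉ upperFaces ω S := by
  obtain ⟨μ, C, hD, hu, hlow, hsrc, hfaces⟩ := h.exists_isCircuit hA hω
  obtain ⟨-, -, hS, h4, -⟩ := h
  obtain ⟨h2, ht₁, h3, hf₁, ht₂, h3', hf₂, hne, l, hl, hbey⟩ := hf
  have hfne : f.Nonempty := Finset.card_pos.1 (by omega)
  by_cases hft : f ∈ halfFaces S μ
  · left
    refine isHullEdge_of_mem_halfFaces hA hS h4 C h2 hft ?_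
    by_contra hfs
    have htgt : halfFaces S μ ⊆ T'.faces := hfaces ▸ Set.subset_union_right
    have m₁ := IsTriangulation.mem_halfFaces_of_star hA hS h4 C htgt hft hfs ht₁ hf₁
    have m₂ := IsTriangulation.mem_halfFaces_of_star hA hS h4 C htgt hft hfs ht₂ hf₂
    have m₁' := m₁
    rw [← hlow] at m₁'
    obtain ⟨-, -, l', hl'⟩ := m₁'
    obtain ⟨p, hp₂, hp₁⟩ : ∃ p ∈ t₂, p ∉ t₁ := by
      by_contra! hcon
      exact hne (Finset.eq_of_subset_of_card_le hcon (by omega)).symm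
    have h5 : ω p < l p := hbey p hp₂ hp₁
    obtain ⟨ν, hν, hνp⟩ := exists_affine_coordinates (T'.indep ht₁) h3 p
    have h6 : l p = l' p := by
      rw [affineMap_apply_of_affine_coordinates hν hνp l,
        affineMap_apply_of_affine_coordinates hν hνp l']
      exact Finset.sum_congr rfl fun q hq => by rw [hl q hq, (hl' q (m₁.2.1 hq)).2.2 hq]
    have := (hl' p (m₂.2.1 hp₂)).1
    linarith
  · right
    have key : ∀ t ∈ T'.faces, f ⊆ t → t ∈ T.faces \ halfFaces S (-μ) := by
      intro t ht hft'
      rw [hfaces] at ht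
      exact ht.resolve_right fun h => hft (halfFaces_down_closed h hft' hfne)
    refine ⟨⟨h2, (key t₁ ht₁ hf₁).1, h3, hf₁, (key t₂ ht₂ hf₂).1, h3', hf₂, hne, l, hl, hbey⟩, ?_⟩
    have hfT' : f ∈ T'.faces := T'.down_closed ht₁ hf₁ hfne
    rw [hu]
    exact (key f hfT' (Finset.Subset.refl f)).2

/-- The invariant of Lawson's algorithm: the stack contains all locally non-regular edges of the
current triangulation. -/
def StackInvariant (A : Finset Plane) (ω : Plane → ℝ) (s : State) : Prop :=
  IsTriangulation A s.1 ∧ ∀ f t₁ t₂, IsLocallyNonRegular .down ω s.1 f t₁ t₂ → f ∈ s.2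

theorem StackInvariant.step (hA : InGeneralPosition A) (hω : IsGenericHeight A ω)
    (hconv : IsConvexHeight A ω) {s s' : State} (hs : StackInvariant A ω s)
    (h : LawsonStep .down A ω s s') : StackInvariant A ω s' := by
  cases h with
  | flip T T' e S L N he hN =>
    obtain ⟨s₁, s₂, hnon, hSeq, hflip⟩ := he
    refine ⟨hflip.2.1, fun f t₁ t₂ hf => List.mem_append.2 ?_⟩
    rcases hf.of_isFlipOn hflip hA hω with hull | ⟨hf', hfu⟩
    · exact Or.inl ((hN.2 f).2 hull)
    · rcases List.mem_cons.1 (hs.2 f t₁ t₂ hf') with rfl | hL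
      -- The popped edge lies in `S`, so the flip removes it unless it is a hull edge, which has
      -- been pushed again; in the present case it would have to survive without being an upper
      -- face.
      · exfalso
        obtain ⟨μ, C, -, hu, -, hsrc, -⟩ := hflip.exists_isCircuit hA hω
        obtain ⟨h2, hs₁, -, hf₁, -⟩ := hnon
        have hs₁S : s₁ ⊆ S := by
          rw [← Finset.coe_subset, hSeq]
          exact Set.subset_union_left
        rw [hu] at hfu
        exact hfu (IsTriangulation.mem_halfFaces_of_subset C.neg hsrc
          (T.down_closed hs₁ hf₁ (Finset.card_pos.1 (by omega))) (hf₁.trans hs₁S))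
      · exact Or.inr hL
  | discard T e L he =>
    refine ⟨hs.1, fun f t₁ t₂ hf => ?_⟩
    rcases List.mem_cons.1 (hs.2 f t₁ t₂ hf) with rfl | hL
    -- Convexity is essential here: a locally non-regular edge is always flippable, so none is lost
    -- by discarding.
    · exact absurd (hs.1.exists_isEdgeFlip_down hA hω hconv hf) he
    · exact hL
  | insert T T' v S N hv hN =>
    obtain ⟨-, -, -, hflip⟩ := hv
    refine ⟨hflip.2.1, fun f t₁ t₂ hf => ?_⟩
    rcases hf.of_isFlipOn hflip hA hω with hull | ⟨hf', -⟩
    · exact (hN.2 f).2 hull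
    · exact absurd (hs.2 f t₁ t₂ hf') List.not_mem_nil

theorem LawsonStep.rank_lt (hA : InGeneralPosition A) (hω : IsGenericHeight A ω) {s s' : State}
    (h : LawsonStep .down A ω s s') :
    toLex (flipRank A ω s'.1, s'.2.length) < toLex (flipRank A ω s.1, s.2.length) := by
  rw [Prod.Lex.toLex_lt_toLex]
  cases h with
  | flip T T' e S L N he hN =>
    obtain ⟨s₁, s₂, hnon, hSeq, hflip⟩ := he
    exact Or.inl (hflip.flipRank_lt hA hω)
  | discard T e L he => exact Or.inr ⟨rfl, by simp⟩
  | insert T T' v S N hv hN => exact Or.inl (hv.2.2.2.flipRank_lt hA hω)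

theorem LawsonStep.terminatesIn_down (hA : InGeneralPosition A) (hω : IsGenericHeight A ω)
    (hconv : IsConvexHeight A ω) (hT : IsTriangulation A T) {L : List (Finset Plane)}
    (hL : ListsEdges T L) :
    TerminatesIn (LawsonStep .down A ω) (T, L) fun s => IsRegularTriangulation A ω s.1 := by
  constructor
  · rintro ⟨f, -, hf⟩
    obtain ⟨n, hn⟩ := WellFounded.not_rel_apply_succ (r := (· < ·))
      (fun n => toLex (flipRank A ω (f n).1, (f n).2.length))
    exact hn ((hf n).rank_lt hA hω)
  · intro s hs hfinal
    have hinv : StackInvariant A ω s := by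
      clear hfinal
      induction hs with
      | refl =>
        refine ⟨hT, fun f t₁ t₂ hf => (hL.2 f).2 ⟨?_, hf.1⟩⟩
        obtain ⟨h2, ht₁, -, hf₁, -⟩ := hf
        exact T.down_closed ht₁ hf₁ (Finset.card_pos.1 (by omega))
      | tail _ h ih => exact ih.step hA hω hconv h
    obtain ⟨T', L'⟩ := s
    cases L' with
    | cons e L' =>
      exfalso
      by_cases he : ∃ S T'', IsEdgeFlip .down A ω e S T' T''
      · obtain ⟨S, T'', he⟩ := he
        obtain ⟨N, hN⟩ := exists_listsHullEdges S
        exact hfinal _ (LawsonStep.flip T' T'' e S L' N he hN)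
      · exact hfinal _ (LawsonStep.discard T' e L' he)
    | nil =>
      refine hinv.1.isRegularTriangulation_of_isConvexHeight hA hω hconv ?_ ?_
      · rintro ⟨v, S, T'', h⟩
        obtain ⟨N, hN⟩ := exists_listsHullEdges S
        exact hfinal _ (LawsonStep.insert T' T'' v S N h hN)
      · rintro ⟨e, t₁, t₂, h⟩
        exact absurd (hinv.2 e t₁ t₂ h) List.not_mem_nil

end

/-! ### Up-flips as down-flips for the negated heights. -/

theorem sourceFaces_up (ω : Plane → ℝ) : sourceFaces .up ω = sourceFaces .down (-ω) :=
  funext fun S => lowerFaces_eq_upperFaces_neg ω S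

theorem targetFaces_up (ω : Plane → ℝ) : targetFaces .up ω = targetFaces .down (-ω) :=
  funext fun S => upperFaces_eq_lowerFaces_neg ω S

theorem isFlipOn_up (A : Finset Plane) (ω : Plane → ℝ) :
    IsFlipOn .up A ω = IsFlipOn .down A (-ω) := by
  funext S T T'
  simp only [IsFlipOn, sourceFaces_up, targetFaces_up]

theorem isDirectedFlip_up (A : Finset Plane) (ω : Plane → ℝ) :
    IsDirectedFlip .up A ω = IsDirectedFlip .down A (-ω) := by
  funext T T'
  simp only [IsDirectedFlip, isFlipOn_up]

theorem isLocallyNonRegular_up (ω : Plane → ℝ) :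
    IsLocallyNonRegular .up ω = IsLocallyNonRegular .down (-ω) := by
  funext T e t₁ t₂
  simp only [IsLocallyNonRegular, Beyond, eq_iff_iff]
  repeat' refine and_congr_right fun _ => ?_
  refine ⟨?_, ?_⟩ <;> rintro ⟨l, hl, hb⟩ <;>
    refine ⟨-l, fun p hp => ?_, fun p hp hp' => ?_⟩ <;>
    first
    | simpa [neg_eq_iff_eq_neg] using hl p hp
    | simpa [neg_lt] using hb p hp hp'

theorem isEdgeFlip_up (A : Finset Plane) (ω : Plane → ℝ) :
    IsEdgeFlip .up A ω = IsEdgeFlip .down A (-ω) := by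
  funext e S T T'
  simp only [IsEdgeFlip, isLocallyNonRegular_up, isFlipOn_up]

theorem isVertexInsertion_up (A : Finset Plane) (ω : Plane → ℝ) :
    IsVertexInsertion .up A ω = IsVertexInsertion .down A (-ω) := by
  funext v S T T'
  simp only [IsVertexInsertion, isFlipOn_up]

theorem lawsonStep_up (A : Finset Plane) (ω : Plane → ℝ) :
    LawsonStep .up A ω = LawsonStep .down A (-ω) := by
  funext s s'
  refine propext ⟨fun h => ?_, fun h => ?_⟩
  · cases h with
    | flip T T' e S L N he hN => exact .flip T T' e S L N (isEdgeFlip_up A ω ▸ he) hN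
    | discard T e L he => exact .discard T e L (isEdgeFlip_up A ω ▸ he)
    | insert T T' v S N hv hN => exact .insert T T' v S N (isVertexInsertion_up A ω ▸ hv) hN
  · cases h with
    | flip T T' e S L N he hN => exact .flip T T' e S L N (isEdgeFlip_up A ω ▸ he) hN
    | discard T e L he => exact .discard T e L (isEdgeFlip_up A ω ▸ he)
    | insert T T' v S N hv hN => exact .insert T T' v S N (isVertexInsertion_up A ω ▸ hv) hN

theorem isFarthestRegularTriangulation_eq (A : Finset Plane) (ω : Plane → ℝ) :
    IsFarthestRegularTriangulation A ω = IsRegularTriangulation A (-ω) := by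
  funext T
  simp only [IsFarthestRegularTriangulation, IsRegularTriangulation, upperFaces_eq_lowerFaces_neg]

theorem IsGenericHeight.neg {A : Finset Plane} {ω : Plane → ℝ} (h : IsGenericHeight A ω) :
    IsGenericHeight A (-ω) := by
  rintro S hS h4 ⟨l, hl⟩
  exact h S hS h4 ⟨-l, fun p hp => by simp [hl p hp]⟩

theorem IsConcaveHeight.neg {A : Finset Plane} {ω : Plane → ℝ} (h : IsConcaveHeight A ω) :
    IsConvexHeight A (-ω) := by
  obtain ⟨g, hg, hgω⟩ := h
  exact ⟨-g, hg.neg, fun p hp => by simp [hgω p hp]⟩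

end LawsonFlip

theorem mainTheorem9 (A : Finset LawsonFlip.Plane) (ω : LawsonFlip.Plane → ℝ)
    (hA : LawsonFlip.InGeneralPosition A) (hω : LawsonFlip.IsGenericHeight A ω) :
    (LawsonFlip.IsConvexHeight A ω →
      ∀ T₀ : LawsonFlip.Complex, LawsonFlip.IsTriangulation A T₀ →
        (∀ L₀ : List (Finset LawsonFlip.Plane), LawsonFlip.ListsEdges T₀ L₀ →
          LawsonFlip.TerminatesIn (LawsonFlip.LawsonStep .down A ω) (T₀, L₀)
            (fun s => LawsonFlip.IsRegularTriangulation A ω s.1)) ∧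
        LawsonFlip.TerminatesIn (LawsonFlip.IsDirectedFlip .down A ω) T₀
          (LawsonFlip.IsRegularTriangulation A ω)) ∧
    (LawsonFlip.IsConcaveHeight A ω →
      ∀ T₀ : LawsonFlip.Complex, LawsonFlip.IsTriangulation A T₀ →
        (∀ L₀ : List (Finset LawsonFlip.Plane), LawsonFlip.ListsEdges T₀ L₀ →
          LawsonFlip.TerminatesIn (LawsonFlip.LawsonStep .up A ω) (T₀, L₀)
            (fun s => LawsonFlip.IsFarthestRegularTriangulation A ω s.1)) ∧
        LawsonFlip.TerminatesIn (LawsonFlip.IsDirectedFlip .up A ω) T₀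
          (LawsonFlip.IsFarthestRegularTriangulation A ω)) := by
  refine ⟨fun h T₀ hT => ⟨fun L₀ hL => ?_, ?_⟩, fun h T₀ hT => ⟨fun L₀ hL => ?_, ?_⟩⟩
  · exact LawsonFlip.LawsonStep.terminatesIn_down hA hω h hT hL
  · exact LawsonFlip.IsDirectedFlip.terminatesIn_down hA hω h hT
  · rw [LawsonFlip.lawsonStep_up, LawsonFlip.isFarthestRegularTriangulation_eq]
    exact LawsonFlip.LawsonStep.terminatesIn_down hA hω.neg h.neg hT hL
  · rw [LawsonFlip.isDirectedFlip_up, LawsonFlip.isFarthestRegularTriangulation_eq]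
    exact LawsonFlip.IsDirectedFlip.terminatesIn_down hA hω.neg h.neg hT
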